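/- Let $R$ be a discrete valuation ring with uniformizer $\pi$, fraction field $K$ and algebraically closed residue field $\kappa$, and let $d\ge 1$. A lattice in $K^d$ is a finitely generated $R$-submodule spanning $K^d$ over $K$; $[L]$ denotes the homothety class $\{aL : a\in K^\times\}$ of $L$. Let $\Gamma$ be a finite set of homothety classes of lattices that is convex: $[L\cap L']\in\Gamma$ whenever $[L],[L']\in\Gamma$. Choose a representative $L_v$ of each $v\in\Gamma$ and put $\overline L_v=L_v/\pi L_v$. For $u,v\in\Gamma$ let $n_{u,v}$ be the minimal integer with $\pi^{n_{u,v}}L_u\subseteq L_v$, and let $f_{u,v}\colon\overline L_u\to\overline L_v$ be the $\kappa$-linear map induced by multiplication by $\pi^{n_{u,v}}$. Let $Q(\Gamma)'$ be the quiver with vertex set $\Gamma$ and exactly one arrow $u\to v$ for each ordered pair $u\neq v$; for a path $\ell$ let $f_\ell$ be the composition of the maps $f_{u,v}$ along $\ell$. Let $Q(\Gamma)$ be obtained from $Q(\Gamma)'$ by removing every arrow $u\to v$ for which there is a path $\ell$ of length at least $2$ in $Q(\Gamma)'$ from $u$ to $v$ with $f_\ell=f_{u,v}$, and let $M_\Gamma=(\overline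 L_v)_{v\in\Gamma}$ be the representation of $Q(\Gamma)$ with the maps $f_{u,v}$. Assume that $\Gamma$ is locally weakly independent, i.e. for every $v\in\Gamma$ there is a subset $I_v\subseteq\Gamma$ such that 1. for every $u\in\Gamma$ with $u\ne v$ there is $w\in I_v$ with $f_{u,v}=f_{w,v}\circ f_{u,w}$; and 2. $\operatorname{im} f_{w,v}=\ker f_{v,w}$ for all $w\in I_v$, and the subspaces $(\operatorname{im} f_{w,v})_{w\in I_v}$ of $\overline L_v$ are linearly independent. Then every sub-representation of $M_\Gamma$ is a finite direct sum of sub-representations each of which is generated by a single vector (at a single vertex) and has dimension at most $1$ at every vertex. Moreover, $M_\Gamma$ is projective in the category of representations of $Q(\Gamma)$ satisfying the relations of $M_\Gamma$ (namely $\ell_1=\ell_2$ for parallel paths $\ell_1,\ell_2$ with $f_{\ell_1}=f_{\ell_2}$, and $\ell=0$ for paths $\ell$ with $f_\ell=0$), and $\Gamma$ is contained in one apartment: there is a $K$-basis $b_1,\dots,b_d$ of $K^d$ such that every element of $\Gamma$ is the class of $\langle\pi^{a_1}b_1,\dots,\pi^{a_d}b_d\rangle_R$ for some $a\in\mathbb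 Z^d$. -/

import Mathlib

open CategoryTheory
open scoped Pointwise

universe u w

noncomputable section

/-! ### Representations of a quiver

A representation of a quiver `Q` over a field `k` is a functor from the path category of `Q`
to `k`-modules, i.e. a family of vector spaces together with a linear map for each arrow. -/

namespace QuiverRep

variable {k : Type*} [Field k] {Q : Type*} [Quiver Q]

/-- A sub-representation: a family of subspaces which is stable under the map of every arrow. -/
structure SubRep (M : Paths Q ⥤ ModuleCat k) where
  /-- the subspace at each vertex -/
  space : ∀ i : Q, Submodule k (M.obj ((Paths.of Q).obj i))
  /-- every arrow maps the subspace at its source into the subspace at its target -/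
  stable : ∀ {i j : Q} (e : i ⟶ j),
    space i ≤ (space j).comap (M.map ((Paths.of Q).map e)).hom

/-- `N` is generated by the vector `x` at the vertex `v`: it is the smallest sub-representation
containing `x`. -/
def SubRep.IsGeneratedBy {M : Paths Q ⥤ ModuleCat k} (N : SubRep M) (v : Q)
    (x : M.obj ((Paths.of Q).obj v)) : Prop :=
  x ∈ N.space v ∧ ∀ T : SubRep M, x ∈ T.space v → ∀ i, N.space i ≤ T.space i

/-- `U` is the internal direct sum of the sub-representations `N a`. -/
def SubRep.IsDirectSum {M : Paths Q ⥤ ModuleCat k} (U : SubRep M) {α : Type*}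
    (N : α → SubRep M) : Prop :=
  ∀ i, iSupIndep (fun a => (N a).space i) ∧ ⨆ a, (N a).space i = U.space i

/-- `N` satisfies the path relations of `M`: two parallel paths that act equally on `M` act equally
on `N`, and a path that acts as zero on `M` acts as zero on `N`. -/
def SatisfiesRelationsOf (M : Paths Q ⥤ ModuleCat k) : ObjectProperty (Paths Q ⥤ ModuleCat k) :=
  fun N => ∀ (i j : Paths Q),
    (∀ p q : i ⟶ j, M.map p = M.map q → N.map p = N.map q) ∧
    (∀ p : i ⟶ j, M.map p = 0 → N.map p = 0)

/-- `M` is projective as a representation of the quiver `Q` bound by the path relations of `M`,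
i.e. it is a projective object of the category of all representations of `Q` that satisfy
these relations. -/
def IsProjectiveBound (M : Paths Q ⥤ ModuleCat k) : Prop :=
  Projective (⟨M, fun _ _ => ⟨fun _ _ h => h, fun _ h => h⟩⟩ :
    (SatisfiesRelationsOf M).FullSubcategory)

end QuiverRep

/-! ### Lattices, homothety classes, convexity, apartments -/

namespace LatticeConfig

variable (R : Type u) [CommRing R] [IsDomain R] [IsDiscreteValuationRing R]
variable (K : Type w) [Field K] [Algebra R K] [IsFractionRing R K]
variable (d : ℕ)

/-- `R`-lattices in `K ^ d`. -/
abbrev Lattice : Type w := {L : Submodule R (Fin d → K) // L.IsLattice K}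

/-- Two lattices are homothetic if `L₁ = a L₂` for a nonzero scalar `a ∈ K`. -/
def homothety : Setoid (Lattice R K d) where
  r L₁ L₂ := ∃ a : Kˣ, L₁.1 = a • L₂.1
  iseqv :=
    { refl := fun L => ⟨1, (one_smul _ _).symm⟩
      symm := fun {L₁ L₂} ⟨a, h⟩ => ⟨a⁻¹, by rw [h, inv_smul_smul]⟩
      trans := fun {L₁ L₂ L₃} ⟨a, h⟩ ⟨b, h'⟩ => ⟨a * b, by rw [h, h', mul_smul]⟩ }

/-- Homothety classes of lattices: the vertices of the affine building of `SL_d` over `K`. -/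
def LatticeClass : Type w := Quotient (homothety R K d)

variable {R K d}

/-- The homothety class of a lattice. -/
def Lattice.cls (L : Lattice R K d) : LatticeClass R K d := Quotient.mk (homothety R K d) L

/-- The intersection of two lattices. -/
def Lattice.inter (L₁ L₂ : Lattice R K d) : Lattice R K d :=
  ⟨L₁.1 ⊓ L₂.1, by
    have := L₁.2
    have := L₂.2
    exact Submodule.IsLattice.inf K L₁.1 L₂.1⟩

/-- A set of lattice classes is convex if it contains the class of the intersection of
any representatives of any two of its members. -/
def IsConvex (Γ : Set (LatticeClass R K d)) : Prop :=
  ∀ L₁ L₂ : Lattice R K d, L₁.cls ∈ Γ → L₂.cls ∈ Γ → (L₁.inter L₂).cls ∈ Γ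

/-- The vertices of the apartment of the basis `b`: the classes of the lattices
`⟨π ^ a₁ b₁, …, π ^ a_d b_d⟩` with `a ∈ ℤ ^ d`. -/
def apartment (π : R) (b : Module.Basis (Fin d) K (Fin d → K)) : Set (LatticeClass R K d) :=
  {c | ∃ (a : Fin d → ℤ) (L : Lattice R K d),
    L.1 = Submodule.span R (Set.range fun k => (algebraMap R K π) ^ a k • b k) ∧ L.cls = c}

/-! ### The maps between the reductions of two lattices -/

/-- The integers `n` with `π ^ n L ⊆ L'`. -/
def exponentSet (π : R) (L L' : Lattice R K d) : Set ℤ :=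
  {n | ∀ x ∈ L.1, (algebraMap R K π) ^ n • x ∈ L'.1}

/-- The minimal integer `n` with `π ^ n L ⊆ L'`. -/
def exponent (π : R) (L L' : Lattice R K d) : ℤ := sInf (exponentSet π L L')

/-- Every vector of `K ^ d` is moved into a given lattice by some power of the uniformizer. -/
theorem exists_pow_smul_mem {π : R} (hπ : Irreducible π) (L : Lattice R K d) (x : Fin d → K) :
    ∃ n : ℕ, π ^ n • x ∈ L.1 := by
  have hx : x ∈ Submodule.span K (L.1 : Set (Fin d → K)) := by
    rw [L.2.span_eq_top]; trivial
  induction hx using Submodule.span_induction with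
  | mem y hy => exact ⟨0, by simpa using hy⟩
  | zero => exact ⟨0, by simp⟩
  | add y z _ _ hy hz =>
    obtain ⟨n, hn⟩ := hy
    obtain ⟨m, hm⟩ := hz
    refine ⟨n + m, ?_⟩
    rw [smul_add]
    refine L.1.add_mem ?_ ?_
    · rw [add_comm, pow_add, mul_smul]; exact L.1.smul_mem _ hn
    · rw [pow_add, mul_smul]; exact L.1.smul_mem _ hm
  | smul c y _ hy =>
    obtain ⟨n, hn⟩ := hy
    obtain ⟨a, b, hb, rfl⟩ := IsFractionRing.div_surjective (A := R) c
    have hb0 : b ≠ 0 := nonZeroDivisors.ne_zero hb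
    obtain ⟨m, v, rfl⟩ := IsDiscreteValuationRing.eq_unit_mul_pow_irreducible hb0 hπ
    refine ⟨m + n, ?_⟩
    have hv : algebraMap R K (v : R) ≠ 0 := by
      simpa using v.ne_zero
    have hp : algebraMap R K π ≠ 0 := by
      simpa using hπ.ne_zero
    have key : π ^ (m + n) • (algebraMap R K a / algebraMap R K (v * π ^ m)) • y
        = (a * (v⁻¹ : Rˣ)) • π ^ n • y := by
      rw [← algebraMap_smul K (π ^ (m + n)), ← algebraMap_smul K (a * (v⁻¹ : Rˣ) : R),
        ← algebraMap_smul K (π ^ n) y, smul_smul, smul_smul]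
      congr 1
      have h1 : algebraMap R K (v⁻¹ : Rˣ) * algebraMap R K (v : R) = 1 := by
        rw [← map_mul]; simp
      rw [map_mul, map_mul, map_pow, map_pow, map_pow, pow_add]
      field_simp
      linear_combination -(algebraMap R K a) * h1
    rw [key]
    exact L.1.smul_mem _ hn

theorem exponentSet_nonempty {π : R} (hπ : Irreducible π) (L L' : Lattice R K d) :
    (exponentSet π L L').Nonempty := by
  obtain ⟨s, hs⟩ := L.2.fg
  choose n hn using exists_pow_smul_mem hπ L'
  refine ⟨((∑ y ∈ s, n y : ℕ) : ℤ), fun x hx => ?_⟩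
  rw [← hs] at hx
  rw [zpow_natCast, ← map_pow, algebraMap_smul]
  induction hx using Submodule.span_induction with
  | mem y hy =>
    obtain ⟨m, hm⟩ := Nat.exists_eq_add_of_le
      (Finset.single_le_sum (f := n) (fun _ _ => Nat.zero_le _) hy)
    rw [hm, add_comm, pow_add, mul_smul]
    exact L'.1.smul_mem _ (hn y)
  | zero => simp
  | add y z _ _ hy hz => rw [smul_add]; exact L'.1.add_mem hy hz
  | smul c y _ hy => rw [smul_comm]; exact L'.1.smul_mem _ hy

theorem exponentSet_bddBelow [NeZero d] {π : R} (hπ : Irreducible π) (L L' : Lattice R K d) :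
    BddBelow (exponentSet π L L') := by
  by_contra hbdd
  have hp : algebraMap R K π ≠ 0 := by
    simpa using hπ.ne_zero
  have hall : ∀ m : ℕ, ∀ x ∈ L.1, (algebraMap R K π) ^ (-(m : ℤ)) • x ∈ L'.1 := by
    intro m x hx
    obtain ⟨n, hn, hlt⟩ := not_bddBelow_iff.1 hbdd (-(m : ℤ))
    obtain ⟨t, ht⟩ := Int.eq_ofNat_of_zero_le (a := -(m : ℤ) - n) (by omega)
    have h := L'.1.smul_mem (π ^ t) (hn x hx)
    rw [← algebraMap_smul K (π ^ t), smul_smul, map_pow, ← zpow_natCast, ← zpow_add₀ hp] at h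
    rwa [show (t : ℤ) + n = -(m : ℤ) by omega] at h
  have hzero : ∀ x ∈ L.1, x = 0 := by
    intro x hx
    have hx' : x ∈ L'.1 := by simpa using hall 0 x hx
    have : Module.Finite R L'.1 := Module.Finite.iff_fg.2 L'.2.fg
    have hk := Ideal.iInf_pow_smul_eq_bot_of_isLocalRing (M := L'.1)
      (IsLocalRing.maximalIdeal R) (Ideal.IsPrime.ne_top')
    have hmem : (⟨x, hx'⟩ : L'.1) ∈
        (⨅ i : ℕ, IsLocalRing.maximalIdeal R ^ i • ⊤ : Submodule R L'.1) := by
      rw [Submodule.mem_iInf]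
      intro m
      have hz := hall m x hx
      have heq : (⟨x, hx'⟩ : L'.1) = π ^ m • ⟨_, hz⟩ := by
        apply Subtype.ext
        simp only [SetLike.mk_smul_mk]
        rw [← algebraMap_smul K (π ^ m), smul_smul, map_pow, ← zpow_natCast, ← zpow_add₀ hp]
        simp
      rw [heq]
      refine Submodule.smul_mem_smul (Ideal.pow_mem_pow ?_ m) trivial
      exact hπ.not_isUnit
    rw [hk, Submodule.mem_bot] at hmem
    exact congrArg Subtype.val hmem
  have hbot : Submodule.span K (L.1 : Set (Fin d → K)) = ⊥ := Submodule.span_eq_bot.2 hzero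
  rw [L.2.span_eq_top] at hbot
  exact top_ne_bot hbot

/-- The minimal exponent is attained. -/
theorem exponent_spec [NeZero d] {π : R} (hπ : Irreducible π) (L L' : Lattice R K d) :
    ∀ x ∈ L.1, (algebraMap R K π) ^ exponent π L L' • x ∈ L'.1 :=
  Int.csInf_mem (exponentSet_nonempty hπ L L') (exponentSet_bddBelow hπ L L')

/-- The map `L → L'` given by multiplication with `π ^ n`, where `n` is minimal
with `π ^ n L ⊆ L'`. -/
def scaleMap [NeZero d] {π : R} (hπ : Irreducible π) (L L' : Lattice R K d) :
    L.1 →ₗ[R] L'.1 where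
  toFun x := ⟨(algebraMap R K π) ^ exponent π L L' • x.1, exponent_spec hπ L L' x.1 x.2⟩
  map_add' _ _ := Subtype.ext (smul_add _ _ _)
  map_smul' _ _ := Subtype.ext (smul_comm _ _ _)

/-- The reduction `L / π L` of a lattice. -/
abbrev Reduction (L : Lattice R K d) : Type w :=
  L.1 ⧸ (IsLocalRing.maximalIdeal R • ⊤ : Submodule R L.1)

/-- The reduction of a lattice is a vector space over the residue field. -/
instance (L : Lattice R K d) : Module (IsLocalRing.ResidueField R) (Reduction L) :=
  inferInstanceAs (Module (R ⧸ IsLocalRing.maximalIdeal R)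
    (L.1 ⧸ (IsLocalRing.maximalIdeal R • ⊤ : Submodule R L.1)))

/-- The map `L / π L → L' / π L'` induced by multiplication with `π ^ n`, where `n` is minimal
with `π ^ n L ⊆ L'`. -/
def redMap [NeZero d] {π : R} (hπ : Irreducible π) (L L' : Lattice R K d) :
    Reduction L →ₗ[IsLocalRing.ResidueField R] Reduction L' where
  toFun := Submodule.mapQ (IsLocalRing.maximalIdeal R • ⊤ : Submodule R L.1)
    (IsLocalRing.maximalIdeal R • ⊤ : Submodule R L'.1) (scaleMap hπ L L')
    (Submodule.smul_le.2 fun r hr x _ => by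
      rw [Submodule.mem_comap, map_smul]
      exact Submodule.smul_mem_smul hr trivial)
  map_add' x y := map_add _ x y
  map_smul' c x := by
    obtain ⟨r, rfl⟩ := IsLocalRing.residue_surjective c
    exact map_smul (Submodule.mapQ (IsLocalRing.maximalIdeal R • ⊤ : Submodule R L.1)
      (IsLocalRing.maximalIdeal R • ⊤ : Submodule R L'.1) (scaleMap hπ L L') _) r x

/-! ### The quiver of a configuration and its representation

A configuration is given by representatives `L i` of its lattice classes. -/

variable {ι : Type*}

/-- The complete quiver on the vertex set `ι`: exactly one arrow `i → j` for all `i ≠ j`. -/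
def CompleteQuiver (ι : Type*) : Type _ := ι

instance : Quiver (CompleteQuiver ι) where
  Hom i j := PLift (i ≠ j)

/-- The composition of the maps `redMap` along a path of the complete quiver. -/
def pathMap [NeZero d] {π : R} (hπ : Irreducible π) (L : ι → Lattice R K d) {i : ι} :
    {j : ι} → Quiver.Path (V := CompleteQuiver ι) i j →
      (Reduction (L i) →ₗ[IsLocalRing.ResidueField R] Reduction (L j))
  | _, .nil => LinearMap.id
  | j, .cons (b := m) p _ => redMap hπ (L m) (L j) ∘ₗ pathMap hπ L p

/-- The vertices of the quiver of the configuration. -/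
def ConfigQuiver [NeZero d] {π : R} (_hπ : Irreducible π) {ι : Type*}
    (_L : ι → Lattice R K d) : Type _ := ι

/-- The quiver of the configuration is obtained from the complete quiver by removing every arrow
`i → j` whose map is equal to the map of a path of length at least `2`. -/
instance [NeZero d] {π : R} (hπ : Irreducible π) (L : ι → Lattice R K d) :
    Quiver (ConfigQuiver hπ L) where
  Hom (i j : ι) := PLift (i ≠ j ∧
    ¬ ∃ p : Quiver.Path (V := CompleteQuiver ι) i j,
      2 ≤ p.length ∧ pathMap hπ L p = redMap hπ (L i) (L j))

/-- The representation of the quiver of the configuration given by the reductions of the lattices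
and the maps `redMap`. -/
def configRep [NeZero d] {π : R} (hπ : Irreducible π) (L : ι → Lattice R K d) :
    Paths (ConfigQuiver hπ L) ⥤ ModuleCat.{w} (IsLocalRing.ResidueField R) :=
  Paths.lift
    { obj := fun i : ι => ModuleCat.of (IsLocalRing.ResidueField R) (Reduction (L i))
      map := fun {i j : ι} _ => ModuleCat.ofHom (redMap hπ (L i) (L j)) }

/-- The condition on the chosen subset `I` of the configuration at the vertex `v`: every map into
`v` from another vertex factors through some `w ∈ I`, and the subspaces
`im f_{w,v} = ker f_{v,w}`, `w ∈ I`, are linearly independent. -/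
def IsWeaklyIndependentAt [NeZero d] {π : R} (hπ : Irreducible π) (L : ι → Lattice R K d)
    (v : ι) : Prop :=
  ∃ I : Set ι,
    (∀ u, u ≠ v → ∃ w ∈ I,
      redMap hπ (L u) (L v) = redMap hπ (L w) (L v) ∘ₗ redMap hπ (L u) (L w)) ∧
    (∀ w ∈ I, LinearMap.range (redMap hπ (L w) (L v)) = LinearMap.ker (redMap hπ (L v) (L w))) ∧
    iSupIndep fun w : I => LinearMap.range (redMap hπ (L w) (L v))

/-- The configuration is convex and locally weakly independent at each of its members. -/
def IsLocallyWeaklyIndependent [NeZero d] {π : R} (hπ : Irreducible π)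
    (Γ : Set (LatticeClass R K d)) (L : Γ → Lattice R K d) : Prop :=
  IsConvex Γ ∧ ∀ v : Γ, IsWeaklyIndependentAt hπ L v

end LatticeConfig

end

/-! ### Families independent modulo a subspace -/

section LinearAlgebra

open Submodule

variable {k V : Type*} [Field k] [AddCommGroup V] [Module k V]

/-! Exponents govern composition: f_{v,w} ∘ f_{u,v} equals f_{u,w} when n_{u,v} + n_{v,w} = n_{u,w},
that is, when v lies on a geodesic from u to w, and is 0 otherwise. Convexity makes the kernel of
each f_{i,j}, i ≠ j, the image of a neighbour s of i, where n_{i,s} + n_{s,i} = 1. `ExponentSystem`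
records these facts, and the main argument no longer sees lattices.

Weak independence makes the configuration tree-like. The maps into u from other vertices fall into
branches, one for each w ∈ I_u, with independent images, and neighbours of u in one branch have
nested images (`range_le_or_ge`). So the kernels at u form finitely many chains inside independent
subspaces. Given a sub-representation U, vectors of U_u that form a basis modulo `rad`, the part
arriving from other vertices, can therefore be adapted to all kernels at once (`exists_adapted`).
Their images at any vertex span (`le_iSup_map`), and the nonzero ones are independent
(`eq_zero_of_sum_dom`); this is the decomposition `exists_generators`.

When U is everything, kernels lie in `rad`, so no generator is ever killed and the same vectors give
a basis at every vertex (`exists_basis`). Lifted to the lattices, they span by Nakayama and give the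
apartment; lifted along an epimorphism, they give projectivity. `exists_path` shows that Q(Γ) still
realises every f_{i,j}. -/

/-- Components of a sum in an independent family, relative to a family of smaller subspaces. -/
theorem iSupIndep.mem_of_sum_mem_iSup {α : Type*} [Fintype α] {W J : α → Submodule k V}
    (hW : iSupIndep W) (hJ : ∀ i, J i ≤ W i) {x : α → V} (hx : ∀ i, x i ∈ W i)
    (h : ∑ i, x i ∈ ⨆ i, J i) (i : α) : x i ∈ J i := by
  obtain ⟨y, hy, hsum⟩ := (Submodule.mem_iSup_iff_exists_finsupp J _).1 h
  have key := (iSupIndep_iff_finsetSum_eq_imp_eq W).1 hW Finset.univ x y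
    (fun i _ => ⟨hx i, hJ i (hy i)⟩) (by
      rw [← hsum, Finsupp.sum_fintype _ _ (fun _ => rfl)]) i (Finset.mem_univ i)
  rw [key]
  exact hy i

/-- A union of families that are independent modulo subspaces of independent subspaces. -/
theorem LinearIndepOn.iUnion_mkQ {α : Type*} [Finite α] {W J : α → Submodule k V}
    (hW : iSupIndep W) (hJ : ∀ i, J i ≤ W i) {E : α → Set V} (hE : ∀ i, E i ⊆ W i)
    (hli : ∀ i, LinearIndepOn k (J i).mkQ (E i)) :
    LinearIndepOn k (⨆ i, J i).mkQ (⋃ i, E i) := by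
  classical
  have := Fintype.ofFinite α
  rw [linearIndepOn_iff']
  intro s g hs hsum e he
  have hex : ∀ e : s, ∃ i, (e : V) ∈ E i := fun e => Set.mem_iUnion.1 (hs e.2)
  choose idx hidx using hex
  have hmem : ∑ e ∈ s, g e • e ∈ ⨆ i, J i := by
    rw [← Submodule.Quotient.mk_eq_zero, ← mkQ_apply, map_sum]
    simpa using hsum
  -- Grouping the terms by the subspace they come from reduces the relation to one inside a single
  -- `W i`, modulo `J i`.
  rw [← Finset.sum_attach, ← Finset.sum_fiberwise s.attach idx] at hmem
  have h := hW.mem_of_sum_mem_iSup hJ (fun i => Submodule.sum_mem _ fun e he => by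
    rw [Finset.mem_filter] at he
    exact (W i).smul_mem _ (hE i (he.2 ▸ hidx e))) hmem (idx ⟨e, he⟩)
  have hl := hli (idx ⟨e, he⟩)
  rw [linearIndepOn_iff'] at hl
  refine hl ((s.attach.filter fun e' => idx e' = idx ⟨e, he⟩).image Subtype.val) g ?_ ?_ e ?_
  · intro x hx
    simp only [Finset.coe_image, Finset.coe_filter, Set.mem_image] at hx
    obtain ⟨y, ⟨-, hy⟩, rfl⟩ := hx
    exact hy ▸ hidx y
  · rw [← Submodule.Quotient.mk_eq_zero, ← mkQ_apply, map_sum] at h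
    rw [Finset.sum_image (fun _ _ _ _ h => Subtype.ext h)]
    simpa using h
  · exact Finset.mem_image.2 ⟨⟨e, he⟩, by simp, rfl⟩

/-- A family independent modulo `J` inside `t` extends to one which spans `t` modulo `J`. -/
theorem LinearIndepOn.exists_extend_mkQ {J : Submodule k V} {E : Set V}
    (h : LinearIndepOn k J.mkQ E) {F : Submodule k V} (hEF : E ⊆ F) :
    ∃ E' : Set V, E ⊆ E' ∧ E' ⊆ F ∧ LinearIndepOn k J.mkQ E' ∧ F ≤ span k E' ⊔ J := by
  refine ⟨h.extend hEF, h.subset_extend hEF, h.extend_subset hEF, h.linearIndepOn_extend hEF, ?_⟩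
  intro x hx
  have := h.image_subset_span_image_extend hEF ⟨x, hx, rfl⟩
  rw [← Submodule.map_span] at this
  obtain ⟨y, hy, hxy⟩ := this
  rw [mkQ_apply, mkQ_apply, Submodule.Quotient.eq] at hxy
  rw [← sub_sub_cancel y x]
  exact sub_mem (mem_sup_left hy) (mem_sup_right hxy)

/-- A family independent modulo `J` and adapted to a finite chain of subspaces. -/
theorem exists_linearIndepOn_mkQ_of_isChain (J : Submodule k V) {C : Set (Submodule k V)}
    (hfin : C.Finite) (hC : IsChain (· ≤ ·) C) :
    ∃ E : Set V, LinearIndepOn k J.mkQ E ∧ (∀ x ∈ E, ∃ F ∈ C, x ∈ F) ∧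
      ∀ F ∈ C, F ≤ span k (E ∩ F) ⊔ J := by
  induction hn : C.ncard generalizing C with
  | zero =>
    rw [Set.ncard_eq_zero hfin] at hn
    subst hn
    exact ⟨∅, linearIndepOn_empty _ _, by simp, by simp⟩
  | succ n ih =>
    have hne : C.Nonempty := by
      rw [Set.nonempty_iff_ne_empty]; rintro rfl; simp at hn
    -- The largest member is removed: the family for the rest lies in `F` and is extended inside
    -- `F`, which keeps the spanning property of the smaller members.
    obtain ⟨F, hF⟩ := hfin.exists_maximal hne
    have htop : ∀ G ∈ C, G ≤ F := fun G hG => by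
      rcases hC.total hG hF.prop with h | h
      · exact h
      · exact hF.le_of_ge hG h
    obtain ⟨E, hE, hEC, hsp⟩ := ih (C := C \ {F}) (hfin.subset Set.sdiff_subset)
      (hC.mono Set.sdiff_subset) (by
        rw [Set.ncard_sdiff_singleton_of_mem hF.prop, hn]; rfl)
    have hEF : E ⊆ F := fun x hx => by
      obtain ⟨G, hG, hxG⟩ := hEC x hx
      exact htop G hG.1 hxG
    obtain ⟨E', h1, h2, h3, h4⟩ := hE.exists_extend_mkQ hEF
    refine ⟨E', h3, fun x hx => ⟨F, hF.prop, h2 hx⟩, fun G hG => ?_⟩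
    by_cases hGF : G = F
    · subst hGF
      rwa [Set.inter_eq_left.2 h2]
    · exact (hsp G ⟨hG, hGF⟩).trans
        (sup_le_sup_right (span_mono (Set.inter_subset_inter_left _ h1)) _)

/-- The vectors occurring in a combination which lies in `span (E ∩ N) + J` belong to `N`. -/
theorem LinearIndepOn.mem_of_sum_mem_sup {J : Submodule k V} {E : Set V} [Fintype E]
    (h : LinearIndepOn k J.mkQ E) {N : Set V} {c : E → k}
    (hx : ∑ e, c e • (e : V) ∈ span k (E ∩ N) ⊔ J) {e : E} (hc : c e ≠ 0) :
    (e : V) ∈ N := by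
  classical
  by_contra hN
  rw [linearIndepOn_iff_notMem_span] at h
  apply h e e.2
  rw [← Submodule.map_span]
  have hle : span k (E ∩ N) ≤ span k (E \ {(e : V)}) := span_mono fun x hx =>
    ⟨hx.1, fun hxe => hN (by rw [← Set.mem_singleton_iff.1 hxe]; exact hx.2)⟩
  have hx' := sup_le_sup_right hle J hx
  rw [← Finset.add_sum_erase _ _ (Finset.mem_univ e)] at hx'
  have hrest : ∑ x ∈ Finset.univ.erase e, c x • (x : V) ∈ span k (E \ {(e : V)}) ⊔ J :=
    mem_sup_left (sum_mem fun x hx => smul_mem _ _ (subset_span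
      ⟨x.2, fun h => Finset.ne_of_mem_erase hx (Subtype.ext h)⟩))
  have h1 := (Submodule.add_mem_iff_left _ hrest).1 hx'
  have h2 := (Submodule.smul_mem_iff _ hc).1 h1
  obtain ⟨y, hy, z, hz, hyz⟩ := mem_sup.1 h2
  refine ⟨y, hy, ?_⟩
  rw [← hyz, map_add, (by simpa using hz : J.mkQ z = 0), add_zero]

end LinearAlgebra

/-! ### Exponent systems and their geodesics -/

/-- Linear maps `f i j` with exponents `n i j`, modelled on the reductions of a finite convex
configuration of lattices. -/
structure ExponentSystem (k : Type*) [Field k] {ι : Type*} (V : ι → Type*)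
    [∀ i, AddCommGroup (V i)] [∀ i, Module k (V i)] where
  /-- the exponents -/
  n : ι → ι → ℤ
  /-- the maps -/
  f : ∀ i j, V i →ₗ[k] V j
  n_self : ∀ i, n i i = 0
  n_triangle : ∀ i j l, n i l ≤ n i j + n j l
  f_self : ∀ i, f i i = LinearMap.id
  f_comp : ∀ i j l, n i j + n j l = n i l → f j l ∘ₗ f i j = f i l
  f_comp_zero : ∀ i j l, n i j + n j l ≠ n i l → f j l ∘ₗ f i j = 0
  f_ne_zero : ∀ i j, f i j ≠ 0
  one_le : ∀ i j, i ≠ j → 1 ≤ n i j + n j i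
  exists_neighbour : ∀ i j, i ≠ j → ∃ s, n i s + n s i = 1 ∧
    LinearMap.range (f s i) = LinearMap.ker (f i j)

namespace ExponentSystem

open Submodule

variable {k : Type*} [Field k] {ι : Type*} {V : ι → Type*}
    [∀ i, AddCommGroup (V i)] [∀ i, Module k (V i)]

/-- `j` lies on a geodesic from `i` to `l`. -/
def Btw (S : ExponentSystem k V) (i j l : ι) : Prop := S.n i j + S.n j l = S.n i l

/-- Local weak independence with respect to the sets `I v`. -/
structure WeaklyIndependent (S : ExponentSystem k V) (I : ι → Set ι) : Prop where
  notMem : ∀ v, v ∉ I v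
  factor : ∀ v u, u ≠ v → ∃ w ∈ I v, S.Btw u w v
  indep : ∀ v, iSupIndep fun w : I v => LinearMap.range (S.f w v)

variable (S : ExponentSystem k V)

theorem Btw.f_apply {S : ExponentSystem k V} {i j l : ι} (h : S.Btw i j l) (x : V i) :
    S.f j l (S.f i j x) = S.f i l x := by
  rw [← S.f_comp i j l h]; rfl

theorem f_self_apply (i : ι) (x : V i) : S.f i i x = x := by rw [S.f_self]; rfl

theorem btw_left (i l : ι) : S.Btw i i l := by simp [Btw, S.n_self]

theorem btw_right (i l : ι) : S.Btw i l l := by simp [Btw, S.n_self]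

theorem Btw.range_le {S : ExponentSystem k V} {i j l : ι} (h : S.Btw i j l) :
    LinearMap.range (S.f i l) ≤ LinearMap.range (S.f j l) := by
  rw [← S.f_comp i j l h]; exact LinearMap.range_comp_le_range _ _

/-- Here and in the next three lemmas two exact equalities leave no slack in the two triangle
inequalities for v, w, u, t taken in this order. -/
theorem Btw.trans_left {S : ExponentSystem k V} {v w u t : ι} (h : S.Btw v w u)
    (h' : S.Btw v u t) : S.Btw w u t := by
  have h1 := S.n_triangle v w t
  have h2 := S.n_triangle w u t
  unfold Btw at *; linarith

theorem Btw.trans_right {S : ExponentSystem k V} {v w u t : ι} (h : S.Btw v w u)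
    (h' : S.Btw v u t) : S.Btw v w t := by
  have h1 := S.n_triangle v w t
  have h2 := S.n_triangle w u t
  unfold Btw at *; linarith

theorem Btw.of_btw {S : ExponentSystem k V} {v w u t : ι} (h : S.Btw w u t)
    (h' : S.Btw v w t) : S.Btw v u t := by
  have h1 := S.n_triangle v w u
  have h2 := S.n_triangle v u t
  unfold Btw at *; linarith

theorem Btw.of_btw' {S : ExponentSystem k V} {v w u t : ι} (h : S.Btw w u t)
    (h' : S.Btw v w t) : S.Btw v w u := by
  have h1 := S.n_triangle v w u
  have h2 := S.n_triangle v u t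
  unfold Btw at *; linarith

theorem not_btw_of_ne {i j : ι} (h : i ≠ j) : ¬ S.Btw i j i := by
  have := S.one_le i j h
  unfold Btw; rw [S.n_self]; omega

/-- The points from which there is a geodesic to `t` through `u`. -/
def dom (u t : ι) : Set ι := {v | S.Btw v u t}

/-- The measure for inductions that move away from `t`. The point `u` is lost: geodesics both from
`u` through `w` and from `w` through `u` would make the round trip between `u` and `w` zero. -/
theorem dom_ncard_lt [Finite ι] {w u t : ι} (h : S.Btw w u t) (hne : w ≠ u) :
    (S.dom w t).ncard < (S.dom u t).ncard := by
  refine Set.ncard_lt_ncard ⟨fun v hv => h.of_btw hv, fun hle => ?_⟩ (Set.toFinite _)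
  have h1 : S.Btw u w t := hle (S.btw_left u t)
  have h2 := S.one_le _ _ hne
  unfold Btw at *; linarith

/-- The points on geodesics from `i` to `j`. -/
def interval (i j : ι) : Set ι := {w | S.Btw i w j}

/-- Cutting a geodesic at an interior point gives smaller intervals, the measure used in
`exists_path`. -/
theorem interval_ncard_lt_left [Finite ι] {i m j : ι} (h : S.Btw i m j) (hne : m ≠ j) :
    (S.interval i m).ncard < (S.interval i j).ncard := by
  refine Set.ncard_lt_ncard ⟨fun w hw => Btw.trans_right hw h, fun hle => ?_⟩ (Set.toFinite _)
  have h1 : S.Btw i j m := hle (S.btw_right i j)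
  have h2 := S.one_le _ _ hne
  unfold Btw at *; linarith

theorem interval_ncard_lt_right [Finite ι] {i m j : ι} (h : S.Btw i m j) (hne : i ≠ m) :
    (S.interval m j).ncard < (S.interval i j).ncard := by
  refine Set.ncard_lt_ncard ⟨fun w hw => Btw.of_btw hw h, fun hle => ?_⟩ (Set.toFinite _)
  have h1 : S.Btw m i j := hle (S.btw_left i j)
  have h2 := S.one_le _ _ hne
  unfold Btw at *; linarith

/-! ### Branches, adapted generators and bases -/

variable {S} {I : ι → Set ι}

/-- Independent subspaces meet in zero. With `W` the image of some map into `v`, this makes the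
branch of a source vertex unique. -/
theorem WeaklyIndependent.eq_of_btw (hI : S.WeaklyIndependent I) {v w w' : ι}
    (hw : w ∈ I v) (hw' : w' ∈ I v) {W : Submodule k (V v)} (hW : W ≠ ⊥)
    (h : W ≤ LinearMap.range (S.f w v)) (h' : W ≤ LinearMap.range (S.f w' v)) : w = w' := by
  by_contra hne
  have := (hI.indep v).pairwiseDisjoint (i := ⟨w, hw⟩) (j := ⟨w', hw'⟩)
    (fun h => hne (congrArg Subtype.val h))
  exact hW (le_bot_iff.1 (this h h'))

theorem range_ne_bot (i j : ι) : LinearMap.range (S.f i j) ≠ ⊥ :=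
  fun h => S.f_ne_zero i j (LinearMap.range_eq_bot.1 h)

/-- The neighbours of `u` in one branch have comparable images. -/
theorem WeaklyIndependent.range_le_or_ge [Finite ι] (hI : S.WeaklyIndependent I) {u : ι} {s s' : ι}
    (hs : S.n u s + S.n s u = 1) (hs' : S.n u s' + S.n s' u = 1) {w : ι} (hwu : w ≠ u)
    (h : S.Btw s w u) (h' : S.Btw s' w u) :
    LinearMap.range (S.f s u) ≤ LinearMap.range (S.f s' u) ∨
      LinearMap.range (S.f s' u) ≤ LinearMap.range (S.f s u) := by
  induction hn : (S.dom w u).ncard using Nat.strong_induction_on generalizing w with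
  | _ n ih =>
    subst hn
    by_cases hsw : s = w
    · subst hsw; exact Or.inr h'.range_le
    by_cases hsw' : s' = w
    · subst hsw'; exact Or.inl h.range_le
    obtain ⟨x, hx, hsx⟩ := hI.factor w s hsw
    obtain ⟨x', hx', hsx'⟩ := hI.factor w s' hsw'
    have hu := S.one_le w u hwu
    -- The round trip from `u` to `r` has length 1 and the one to `w` has length at least 1, so the
    -- triangle inequality for u, r, w is an equality.
    have key : ∀ r, S.n u r + S.n r u = 1 → S.Btw r w u → S.Btw u r w := by
      intro r h1 h2
      have h3 := S.n_triangle u r w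
      unfold Btw at *
      linarith
    -- By `key` the nonzero image of `f u w` lies in the images of both `x` and `x'`, so both
    -- geodesics continue backwards through the same point.
    have hxx : x = x' := hI.eq_of_btw hx hx' (range_ne_bot u w)
      ((key s hs h).range_le.trans hsx.range_le) ((key s' hs' h').range_le.trans hsx'.range_le)
    subst hxx
    have hxw : x ≠ w := fun e => hI.notMem w (e ▸ hx)
    have hxu : S.Btw x w u := hsx.trans_left h
    refine ih _ (S.dom_ncard_lt hxu hxw) ?_ (hsx.trans_right h) (hsx'.trans_right h') rfl
    rintro rfl
    exact S.not_btw_of_ne hwu.symm hxu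

variable (S) in
/-- The part of the subspace at `u` which comes from the points of `I u`. -/
def rad (I : ι → Set ι) (U : ∀ i, Submodule k (V i)) (u : ι) : Submodule k (V u) :=
  ⨆ w : I u, (U w).map (S.f w u)

theorem rad_le {U : ∀ i, Submodule k (V i)} (hU : ∀ i j, U i ≤ (U j).comap (S.f i j)) (u : ι) :
    S.rad I U u ≤ U u :=
  iSup_le fun w => Submodule.map_le_iff_le_comap.2 (hU w u)

/-- Every map into `u` factors through `I u`, so `rad` absorbs the contributions of all other
vertices. -/
theorem WeaklyIndependent.map_mem_rad (hI : S.WeaklyIndependent I) {U : ∀ i, Submodule k (V i)}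
    (hU : ∀ i j, U i ≤ (U j).comap (S.f i j)) {v u : ι} (hvu : v ≠ u) {x : V v} (hx : x ∈ U v) :
    S.f v u x ∈ S.rad I U u := by
  obtain ⟨w, hw, hb⟩ := hI.factor u v hvu
  rw [← hb.f_apply]
  exact mem_iSup_of_mem (⟨w, hw⟩ : I u) (mem_map_of_mem (hU v w hx))

/-- Each kernel lies in a single branch: convexity supplies the neighbour `s`, and a geodesic from
`s` to `u` meets `I u`. -/
theorem WeaklyIndependent.exists_ker_eq (hI : S.WeaklyIndependent I) {u t : ι} (h : u ≠ t) :
    ∃ w ∈ I u, ∃ s, S.n u s + S.n s u = 1 ∧ S.Btw s w u ∧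
      LinearMap.ker (S.f u t) = LinearMap.range (S.f s u) := by
  obtain ⟨s, hs, hr⟩ := S.exists_neighbour u t h
  have hne : s ≠ u := by rintro rfl; simp [S.n_self] at hs
  obtain ⟨w, hw, hb⟩ := hI.factor u s hne
  exact ⟨w, hw, s, hs, hb, hr.symm⟩

/-- Generators at the point `u` which are compatible with the kernels of all maps out of `u`. -/
theorem WeaklyIndependent.exists_adapted [Finite ι] (hI : S.WeaklyIndependent I)
    (U : ∀ i, Submodule k (V i)) (u : ι) :
    ∃ E : Set (V u), E ⊆ U u ∧ LinearIndepOn k (S.rad I U u).mkQ E ∧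
      U u ≤ span k E ⊔ S.rad I U u ∧
      ∀ t, U u ⊓ LinearMap.ker (S.f u t) ≤
        span k (E ∩ LinearMap.ker (S.f u t)) ⊔ S.rad I U u := by
  -- The traces on `U u` of the images of neighbours in branch `w`. By `exists_ker_eq` every kernel
  -- of a map to another vertex has its trace in one of these chains.
  let C : I u → Set (Submodule k (V u)) := fun w =>
    (fun s => U u ⊓ LinearMap.range (S.f s u)) '' {s | S.n u s + S.n s u = 1 ∧ S.Btw s w u}
  have hchain : ∀ w, IsChain (· ≤ ·) (C w) := by
    rintro w _ ⟨s, ⟨hs, hb⟩, rfl⟩ _ ⟨s', ⟨hs', hb'⟩, rfl⟩ -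
    have hwu : (w : ι) ≠ u := fun h => hI.notMem u (by have := w.2; rwa [h] at this)
    exact (hI.range_le_or_ge hs hs' hwu hb hb').imp (inf_le_inf_left _) (inf_le_inf_left _)
  choose E hEli hEC hEsp using fun w : I u => exists_linearIndepOn_mkQ_of_isChain
    ((U w).map (S.f w u)) ((Set.toFinite _).image _ : (C w).Finite) (hchain w)
  have hEU : ∀ w, E w ⊆ (U u ⊓ LinearMap.range (S.f w u) : Submodule k (V u)) := by
    intro w x hx
    obtain ⟨_, ⟨s, ⟨-, hb⟩, rfl⟩, hxF⟩ := hEC w x hx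
    exact inf_le_inf_left _ hb.range_le hxF
  have hli : LinearIndepOn k (S.rad I U u).mkQ (⋃ w, E w) :=
    LinearIndepOn.iUnion_mkQ (hI.indep u) (fun w => LinearMap.map_le_range)
      (fun w => (hEU w).trans fun x hx => hx.2) hEli
  obtain ⟨E', h1, h2, h3, h4⟩ := hli.exists_extend_mkQ
    (F := U u) (Set.iUnion_subset fun w => (hEU w).trans fun x hx => hx.1)
  refine ⟨E', h2, h3, h4, fun t => ?_⟩
  by_cases hut : u = t
  · subst hut
    rw [S.f_self, LinearMap.ker_id, inf_bot_eq]
    exact bot_le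
  obtain ⟨w, hw, s, hs, hb, hk⟩ := hI.exists_ker_eq hut
  rw [hk]
  refine (hEsp ⟨w, hw⟩ _ ⟨s, ⟨hs, hb⟩, rfl⟩).trans (sup_le_sup (span_mono ?_) ?_)
  · exact Set.inter_subset_inter ((Set.subset_iUnion E _).trans h1) fun x hx => hx.2
  · exact le_iSup (fun w : I u => (U w).map (S.f w u)) ⟨w, hw⟩

open scoped Classical in
/-- Independence of the images at `t` of vectors at different points. -/
theorem WeaklyIndependent.eq_zero_of_sum_dom [Fintype ι] (hI : S.WeaklyIndependent I)
    {U : ∀ i, Submodule k (V i)} (hU : ∀ i j, U i ≤ (U j).comap (S.f i j))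
    {C : ∀ i, Submodule k (V i)} (hCU : ∀ i, C i ≤ U i)
    (hC : ∀ u t, C u ⊓ (LinearMap.ker (S.f u t) ⊔ S.rad I U u) ≤ LinearMap.ker (S.f u t))
    {x : ∀ i, V i} (hx : ∀ i, x i ∈ C i) {u t : ι}
    (h : ∑ v with S.Btw v u t, S.f v t (x v) = 0) {v : ι} (hv : S.Btw v u t) :
    S.f v t (x v) = 0 := by
  induction hn : (S.dom u t).ncard using Nat.strong_induction_on generalizing u v with
  | _ n ih =>
    subst hn
    set D := Finset.univ.filter fun v => S.Btw v u t with hD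
    have huD : u ∈ D := by simp [hD, S.btw_left]
    have hsplit : ∑ v ∈ D, S.f v u (x v) = x u + ∑ v ∈ D.erase u, S.f v u (x v) := by
      rw [← Finset.add_sum_erase D _ huD, S.f_self_apply]
    have hker : ∑ v ∈ D, S.f v u (x v) ∈ LinearMap.ker (S.f u t) := by
      rw [LinearMap.mem_ker, map_sum, ← h]
      exact Finset.sum_congr rfl fun v hv => ((Finset.mem_filter.1 hv).2).f_apply _
    have hrad : ∑ v ∈ D.erase u, S.f v u (x v) ∈ S.rad I U u :=
      sum_mem fun v hv => hI.map_mem_rad hU (Finset.ne_of_mem_erase hv) (hCU v (hx v))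
    -- The whole sum at `u` dies at `t`, and its terms from other vertices lie in `rad`; hence `hC`
    -- applies to `x u`.
    have hxu : x u ∈ LinearMap.ker (S.f u t) := by
      refine hC u t ⟨hx u, ?_⟩
      rw [eq_sub_of_add_eq hsplit.symm]
      exact sub_mem (mem_sup_left hker) (mem_sup_right hrad)
    by_cases hvu : v = u
    · subst hvu; exact hxu
    have hy : ∑ v ∈ D.erase u, S.f v u (x v) ∈ LinearMap.ker (S.f u t) := by
      rw [hsplit] at hker
      exact (Submodule.add_mem_iff_right _ hxu).1 hker
    -- the components along the points of `I u`
    let y : I u → V u := fun w => ∑ v ∈ (D.erase u).filter fun v => S.Btw v w u, S.f v u (x v)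
    have hyr : ∀ w : I u, y w ∈ LinearMap.range (S.f w u) := fun w =>
      sum_mem fun v hv => (Finset.mem_filter.1 hv).2.range_le ⟨_, rfl⟩
    have hysum : ∑ w, y w = ∑ v ∈ D.erase u, S.f v u (x v) := by
      simp only [y, Finset.sum_filter]
      rw [Finset.sum_comm]
      refine Finset.sum_congr rfl fun v hv => ?_
      obtain ⟨w, hw, hb⟩ := hI.factor u v (Finset.ne_of_mem_erase hv)
      rw [Finset.sum_eq_single (⟨w, hw⟩ : I u), if_pos hb]
      · intro w' _ hne
        rw [if_neg]
        exact fun hb' => hne (Subtype.ext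
          (hI.eq_of_btw w'.2 hw (range_ne_bot v u) hb'.range_le hb.range_le))
      · simp
    -- The kernel is placed in its own branch, with zero in the others, so that independence puts
    -- each component `y w` in the kernel separately.
    obtain ⟨J, hJr, hJle, hJ⟩ : ∃ J : I u → Submodule k (V u),
        (∀ w, J w ≤ LinearMap.range (S.f w u)) ∧ (∀ w, J w ≤ LinearMap.ker (S.f u t)) ∧
        LinearMap.ker (S.f u t) ≤ ⨆ w, J w := by
      by_cases hut : u = t
      · subst hut
        exact ⟨fun _ => ⊥, fun _ => bot_le, fun _ => bot_le, by
          rw [S.f_self, LinearMap.ker_id]; exact bot_le⟩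
      obtain ⟨w₀, hw₀, s, -, hs, hk⟩ := hI.exists_ker_eq hut
      refine ⟨fun w => if w = ⟨w₀, hw₀⟩ then LinearMap.ker (S.f u t) else ⊥, fun w => ?_,
        fun w => ?_, ?_⟩
      · dsimp only
        split_ifs with hw
        · subst hw; rw [hk]; exact hs.range_le
        · exact bot_le
      · dsimp only
        split_ifs
        · exact le_rfl
        · exact bot_le
      · exact le_iSup_of_le (⟨w₀, hw₀⟩ : I u) (by dsimp only; rw [if_pos rfl])
    have hyker : ∀ w : I u, y w ∈ LinearMap.ker (S.f u t) := fun w =>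
      hJle w ((hI.indep u).mem_of_sum_mem_iSup hJr hyr (hJ (hysum ▸ hy)) w)
    obtain ⟨w, hw, hb⟩ := hI.factor u v hvu
    have hwt : S.Btw w u t := hb.trans_left hv
    have hwu : w ≠ u := fun e => hI.notMem u (e ▸ hw)
    refine ih _ (S.dom_ncard_lt hwt hwu) ?_ (hb.trans_right hv) rfl
    have hzero := hyker ⟨w, hw⟩
    rw [LinearMap.mem_ker, map_sum] at hzero
    rw [← hzero]
    refine Finset.sum_congr ?_ fun v hv => ?_
    -- The vertices with a geodesic to `t` through `w` are exactly those of `D` other than `u` that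
    -- reach `u` through `w`.
    · ext v'
      simp only [Finset.mem_filter, Finset.mem_univ, true_and, Finset.mem_erase, hD]
      refine ⟨fun hv' => ⟨⟨fun e => ?_, hwt.of_btw hv'⟩, hwt.of_btw' hv'⟩,
        fun hv' => hv'.2.trans_right hv'.1.2⟩
      rw [e] at hv'
      exact S.not_btw_of_ne hwu.symm (hwt.of_btw' hv')
    · have hvD := Finset.mem_of_mem_erase (Finset.mem_filter.1 hv).1
      exact ((Finset.mem_filter.1 hvD).2.f_apply _).symm

/-- Modulo `C u`, vectors come from points `w` of `I u`: either `w` is farther out on a geodesic to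
`t` through `u`, and induction applies, or the composite to `t` is zero. -/
theorem WeaklyIndependent.le_iSup_map [Finite ι] (hI : S.WeaklyIndependent I)
    {U C : ∀ i, Submodule k (V i)} (hUC : ∀ i, U i ≤ C i ⊔ S.rad I U i) (u t : ι) :
    (U u).map (S.f u t) ≤ ⨆ v, (C v).map (S.f v t) := by
  induction hn : (S.dom u t).ncard using Nat.strong_induction_on generalizing u with
  | _ n ih =>
    subst hn
    refine (Submodule.map_mono (hUC u)).trans ?_
    rw [Submodule.map_sup, rad, Submodule.map_iSup]
    refine sup_le (le_iSup (fun v => (C v).map (S.f v t)) u) (iSup_le fun w => ?_)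
    rw [← Submodule.map_comp]
    by_cases hb : S.Btw w u t
    · rw [S.f_comp _ _ _ hb]
      refine ih _ (S.dom_ncard_lt hb ?_) w rfl
      intro h
      exact hI.notMem u (by have := w.2; rwa [h] at this)
    · rw [S.f_comp_zero _ _ _ hb, Submodule.map_zero]
      exact bot_le

/-- Every stable family of subspaces is the direct sum of families generated by one vector. -/
theorem WeaklyIndependent.exists_generators [Finite ι] [∀ i, FiniteDimensional k (V i)]
    (hI : S.WeaklyIndependent I)
    {U : ∀ i, Submodule k (V i)} (hU : ∀ i j, U i ≤ (U j).comap (S.f i j)) :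
    ∃ (m : ℕ) (v : Fin m → ι) (e : ∀ a, V (v a)), (∀ a, e a ∈ U (v a)) ∧
      (∀ a, e a ∉ S.rad I U (v a)) ∧
      ∀ i, iSupIndep (fun a => span k {S.f (v a) i (e a)}) ∧
        ⨆ a, span k {S.f (v a) i (e a)} = U i := by
  classical
  have := Fintype.ofFinite ι
  choose E hEU hEli hEsp hEker using hI.exists_adapted U
  have := fun i => (hEli i).linearIndependent.finite
  have := fun i => Fintype.ofFinite (E i)
  -- vanishing of a combination forces the vanishing of all its terms
  have hterm : ∀ u t (c : E u → k),
      ∑ e, c e • (e : V u) ∈ LinearMap.ker (S.f u t) ⊔ S.rad I U u →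
      ∀ e, c e • S.f u t e = 0 := by
    intro u t c h e
    by_cases hc : c e = 0
    · rw [hc, zero_smul]
    have hsU : ∑ e, c e • (e : V u) ∈ U u := sum_mem fun e _ => smul_mem _ _ (hEU u e.2)
    have hmem : ∑ e, c e • (e : V u) ∈
        span k (E u ∩ LinearMap.ker (S.f u t)) ⊔ S.rad I U u := by
      obtain ⟨y, hy, z, hz, hyz⟩ := mem_sup.1 h
      have hyU : y ∈ U u := by
        rw [eq_sub_of_add_eq hyz]
        exact sub_mem hsU (rad_le hU u hz)
      rw [← hyz]
      exact add_mem (hEker u t ⟨hyU, hy⟩) (mem_sup_right hz)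
    have : (e : V u) ∈ LinearMap.ker (S.f u t) := (hEli u).mem_of_sum_mem_sup hmem hc
    rw [LinearMap.mem_ker.1 this, smul_zero]
  have hC : ∀ u t, span k (E u) ⊓ (LinearMap.ker (S.f u t) ⊔ S.rad I U u) ≤
      LinearMap.ker (S.f u t) := by
    rintro u t x ⟨hx, hx'⟩
    rw [← Subtype.range_coe (s := E u)] at hx
    obtain ⟨c, rfl⟩ := (mem_span_range_iff_exists_fun k).1 hx
    rw [LinearMap.mem_ker, map_sum]
    exact Finset.sum_eq_zero fun e _ => by rw [map_smul]; exact hterm u t c hx' e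
  let A := Σ i, E i
  obtain ⟨m, ⟨φ⟩⟩ := Finite.exists_equiv_fin A
  refine ⟨m, fun a => (φ.symm a).1, fun a => (φ.symm a).2, fun a => hEU _ (φ.symm a).2.2,
    fun a ha => ?_, fun i => ⟨?_, ?_⟩⟩
  · have h0 := (hEli (φ.symm a).1).ne_zero (φ.symm a).2.2
    exact h0 (by simpa using ha)
  · suffices h : iSupIndep fun a : A => span k {S.f a.1 i a.2} from h.comp φ.symm.injective
    rw [iSupIndep_iff_finsetSum_eq_zero_imp_eq_zero]
    intro s z hz hsum a ha
    choose! c hc using fun b hb => mem_span_singleton.1 (hz b hb)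
    let c' : A → k := fun b => if b ∈ s then c b else 0
    have hc' : ∀ b ∈ s, c' b • S.f b.1 i b.2 = z b := fun b hb => by
      simp only [c', if_pos hb, hc b hb]
    let x : ∀ v, V v := fun v => ∑ e : E v, c' ⟨v, e⟩ • (e : V v)
    have hx : ∀ v, S.f v i (x v) = ∑ e : E v, c' ⟨v, e⟩ • S.f v i e := fun v => by
      simp only [x, map_sum, map_smul]
    -- Taking `u = t = i` imposes no restriction on `v`.
    have hsum' : ∑ v with S.Btw v i i, S.f v i (x v) = 0 := by
      rw [Finset.filter_true_of_mem fun v _ => S.btw_right v i, ← hsum]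
      simp only [hx]
      rw [← Fintype.sum_sigma' (fun v (e : E v) => c' ⟨v, e⟩ • S.f v i e)]
      rw [← Finset.sum_subset (Finset.subset_univ s)]
      · exact Finset.sum_congr rfl hc'
      · intro b _ hb
        exact (congrArg (· • S.f b.1 i b.2) (if_neg hb)).trans (zero_smul _ _)
    have hzero := hI.eq_zero_of_sum_dom hU (fun v => span_le.2 (hEU v)) hC
      (fun v => sum_mem fun e _ => smul_mem _ _ (subset_span e.2)) hsum' (S.btw_right a.1 i)
    rw [← hc' a ha]
    -- The previous step separates the vertices; adaptedness to kernels separates the vectors at one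
    -- vertex.
    exact hterm a.1 i (fun e => c' ⟨a.1, e⟩) (mem_sup_left hzero) a.2
  · apply le_antisymm
    · refine iSup_le fun a => ?_
      rw [span_singleton_le_iff_mem]
      exact hU _ i (hEU _ (φ.symm a).2.2)
    · have h := hI.le_iSup_map hEsp i i
      rw [S.f_self, Submodule.map_id] at h
      refine h.trans (iSup_le fun v => ?_)
      rw [Submodule.map_span, span_le]
      rintro _ ⟨e, he, rfl⟩
      have key : ∀ a : A, a = ⟨v, e, he⟩ → S.f v i e ∈ span k {S.f a.1 i a.2} := by
        rintro _ rfl; exact mem_span_singleton_self _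
      exact mem_iSup_of_mem (φ ⟨v, e, he⟩) (key _ (φ.symm_apply_apply _))

/-- There are finitely many vectors whose images form a basis at every point. -/
theorem WeaklyIndependent.exists_basis [Finite ι] [∀ i, FiniteDimensional k (V i)]
    (hI : S.WeaklyIndependent I) :
    ∃ (m : ℕ) (v : Fin m → ι) (e : ∀ a, V (v a)), ∀ i, ∃ b : Module.Basis (Fin m) k (V i),
      ∀ a, b a = S.f (v a) i (e a) := by
  obtain ⟨m, v, e, -, hrad, h⟩ := hI.exists_generators (U := fun _ => ⊤) fun _ _ => le_top
  refine ⟨m, v, e, fun i => ?_⟩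
  obtain ⟨hind, hsup⟩ := h i
  have hne : ∀ a, S.f (v a) i (e a) ≠ 0 := by
    intro a ha
    by_cases hai : v a = i
    · refine hrad a ?_
      have : e a = 0 := by
        rw [← S.f_self_apply (v a) (e a)]
        rw [← hai] at ha
        exact ha
      rw [this]
      exact zero_mem _
    -- A killed generator would lie in the image of some `w ∈ I (v a)`, hence in `rad`.
    · obtain ⟨w, hw, s, -, hs, hk⟩ := hI.exists_ker_eq hai
      have hmem : e a ∈ LinearMap.range (S.f w (v a)) := by
        refine hs.range_le (hk ▸ ?_)
        exact ha
      obtain ⟨y, hy⟩ := hmem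
      refine hrad a (hy ▸ hI.map_mem_rad (fun _ _ => le_top) ?_ mem_top)
      rintro rfl
      exact hI.notMem _ hw
  have hli : LinearIndependent k fun a => S.f (v a) i (e a) :=
    hind.linearIndependent _ (fun a => mem_span_singleton_self _) hne
  refine ⟨Module.Basis.mk hli ?_, fun a => by rw [Module.Basis.mk_apply]⟩
  rw [← hsup]
  exact iSup_le fun a => span_mono (Set.singleton_subset_iff.2 ⟨a, rfl⟩)

end ExponentSystem

/-! ### Exponents and reduction maps of lattices -/

noncomputable section

namespace LatticeConfig

variable {R : Type u} [CommRing R] [IsDomain R] [IsDiscreteValuationRing R]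
variable {K : Type w} [Field K] [Algebra R K] [IsFractionRing R K]
variable {d : ℕ} {π : R}

theorem algebraMap_uniformizer_ne_zero (hπ : Irreducible π) : algebraMap R K π ≠ 0 := by
  simpa using hπ.ne_zero

/-- Every nonzero element of the fraction field is a unit times a power of the uniformizer. -/
theorem exists_unit_mul_zpow (hπ : Irreducible π) (a : Kˣ) :
    ∃ (r : Rˣ) (n : ℤ), (a : K) = algebraMap R K r * algebraMap R K π ^ n := by
  obtain ⟨x, y, hy, hxy⟩ := IsFractionRing.div_surjective (A := R) (a : K)
  have hp := algebraMap_uniformizer_ne_zero (K := K) hπ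
  have hy0 : y ≠ 0 := nonZeroDivisors.ne_zero hy
  have hx0 : x ≠ 0 := by
    rintro rfl
    exact a.ne_zero (by rw [← hxy, map_zero, zero_div])
  obtain ⟨m, r, rfl⟩ := IsDiscreteValuationRing.eq_unit_mul_pow_irreducible hx0 hπ
  obtain ⟨n, s, rfl⟩ := IsDiscreteValuationRing.eq_unit_mul_pow_irreducible hy0 hπ
  refine ⟨r * s⁻¹, (m : ℤ) - n, ?_⟩
  have hs : algebraMap R K s ≠ 0 := by simp
  have hinv : algebraMap R K (s⁻¹ : Rˣ) = (algebraMap R K s)⁻¹ := by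
    refine eq_inv_of_mul_eq_one_left ?_; rw [← map_mul]; simp
  rw [← hxy, Units.val_mul, map_mul, map_mul, map_mul, hinv, zpow_sub₀ hp, map_pow, map_pow,
    zpow_natCast, zpow_natCast]
  field_simp

theorem zpow_smul_zpow_smul (hπ : Irreducible π) (m n : ℤ) (x : Fin d → K) :
    (algebraMap R K π) ^ m • (algebraMap R K π) ^ n • x = (algebraMap R K π) ^ (m + n) • x := by
  rw [smul_smul, zpow_add₀ (algebraMap_uniformizer_ne_zero hπ)]

theorem zpow_smul_mem_of_le (hπ : Irreducible π) (L : Lattice R K d) {m n : ℤ} (h : m ≤ n)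
    {x : Fin d → K} (hx : (algebraMap R K π) ^ m • x ∈ L.1) :
    (algebraMap R K π) ^ n • x ∈ L.1 := by
  obtain ⟨t, rfl⟩ := Int.le.dest h
  have := L.1.smul_mem (π ^ t) hx
  rwa [← algebraMap_smul K (π ^ t), map_pow, ← zpow_natCast, zpow_smul_zpow_smul hπ,
    add_comm] at this

theorem mem_units_smul_iff (a : Kˣ) (N : Submodule R (Fin d → K)) (x : Fin d → K) :
    x ∈ a • N ↔ a⁻¹ • x ∈ N := by
  constructor
  · rintro ⟨y, hy, rfl⟩
    exact (inv_smul_smul a y).symm ▸ hy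
  · exact fun h => ⟨_, h, by exact smul_inv_smul a x⟩

/-- The lattice `a L`. -/
def Lattice.scale (a : Kˣ) (L : Lattice R K d) : Lattice R K d :=
  ⟨a • L.1, have := L.2; Submodule.IsLattice.smul K L.1 a⟩

theorem Lattice.scale_cls (a : Kˣ) (L : Lattice R K d) : (L.scale a).cls = L.cls :=
  Quotient.sound ⟨a, rfl⟩

/-- Homothetic lattices differ by a power of the uniformizer. -/
theorem exists_zpow_of_cls_eq (hπ : Irreducible π) {N L : Lattice R K d} (h : N.cls = L.cls) :
    ∃ n : ℤ, ∀ x, x ∈ N.1 ↔ (algebraMap R K π) ^ (-n) • x ∈ L.1 := by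
  obtain ⟨a, ha⟩ : ∃ a : Kˣ, N.1 = a • L.1 := Quotient.exact h
  obtain ⟨r, n, hr⟩ := exists_unit_mul_zpow hπ a
  have hp := algebraMap_uniformizer_ne_zero (K := K) hπ
  refine ⟨n, fun x => ?_⟩
  have key : (algebraMap R K π) ^ (-n) • x = (r : R) • a⁻¹ • x := by
    rw [← algebraMap_smul K (r : R), Units.smul_def, smul_smul, Units.val_inv_eq_inv_val, hr]
    congr 1
    have hr0 : algebraMap R K r ≠ 0 := by simp
    rw [zpow_neg]
    field_simp
  rw [ha, mem_units_smul_iff, key]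
  constructor
  · exact fun h => L.1.smul_mem _ h
  · intro h
    have := L.1.smul_mem (r⁻¹ : Rˣ) h
    rwa [smul_smul, Units.inv_mul, one_smul] at this

theorem cls_eq_of_forall_mem_iff (hπ : Irreducible π) {N L : Lattice R K d} (n : ℤ)
    (h : ∀ x, x ∈ N.1 ↔ (algebraMap R K π) ^ (-n) • x ∈ L.1) : N.cls = L.cls := by
  have hp := algebraMap_uniformizer_ne_zero (K := K) hπ
  refine Quotient.sound ⟨Units.mk0 _ (zpow_ne_zero n hp), ?_⟩
  ext x
  rw [mem_units_smul_iff, h, Units.smul_def, zpow_neg]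
  simp

section Exponent

variable [NeZero d] (hπ : Irreducible π) (L₁ L₂ L₃ : Lattice R K d)
include hπ

theorem exponent_le {n : ℤ} (h : ∀ x ∈ L₁.1, (algebraMap R K π) ^ n • x ∈ L₂.1) :
    exponent π L₁ L₂ ≤ n :=
  csInf_le (exponentSet_bddBelow hπ L₁ L₂) h

theorem exponent_triangle : exponent π L₁ L₃ ≤ exponent π L₁ L₂ + exponent π L₂ L₃ := by
  refine exponent_le hπ _ _ fun x hx => ?_
  rw [add_comm, ← zpow_smul_zpow_smul hπ]
  exact exponent_spec hπ _ _ _ (exponent_spec hπ _ _ _ hx)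

theorem exponent_self : exponent π L₁ L₁ = 0 := by
  have h1 : exponent π L₁ L₁ ≤ 0 := exponent_le hπ _ _ fun x hx => by simpa using hx
  have h2 := exponent_triangle hπ L₁ L₁ L₁
  omega

end Exponent

/-- The class of an element of a lattice in its reduction. -/
def Lattice.red (L : Lattice R K d) (x : L.1) : Reduction L :=
  Submodule.Quotient.mk x

theorem Lattice.red_surjective (L : Lattice R K d) : Function.Surjective L.red :=
  Submodule.Quotient.mk_surjective _

theorem Lattice.red_eq_zero_iff (hπ : Irreducible π) (L : Lattice R K d) (x : L.1) :
    L.red x = 0 ↔ (algebraMap R K π) ^ (-1 : ℤ) • x.1 ∈ L.1 := by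
  have hp := algebraMap_uniformizer_ne_zero (K := K) hπ
  rw [Lattice.red, Submodule.Quotient.mk_eq_zero, hπ.maximalIdeal_eq,
    Submodule.ideal_span_singleton_smul, Submodule.mem_smul_pointwise_iff_exists]
  constructor
  · rintro ⟨y, -, rfl⟩
    rw [Submodule.coe_smul, ← algebraMap_smul K π, smul_smul, zpow_neg_one, inv_mul_cancel₀ hp,
      one_smul]
    exact y.2
  · intro h
    refine ⟨⟨_, h⟩, trivial, Subtype.ext ?_⟩
    rw [Submodule.coe_smul, ← algebraMap_smul K π, smul_smul, zpow_neg_one, mul_inv_cancel₀ hp,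
      one_smul]

section RedMap

variable [NeZero d] (hπ : Irreducible π)

theorem redMap_red (L L' : Lattice R K d) (x : L.1) :
    redMap hπ L L' (L.red x) = L'.red ⟨_, exponent_spec hπ L L' x.1 x.2⟩ := rfl

theorem redMap_red_eq_zero_iff (L L' : Lattice R K d) (x : L.1) :
    redMap hπ L L' (L.red x) = 0 ↔
      (algebraMap R K π) ^ (exponent π L L' - 1) • x.1 ∈ L'.1 := by
  rw [redMap_red, L'.red_eq_zero_iff hπ, zpow_smul_zpow_smul hπ, neg_add_eq_sub]

theorem redMap_ne_zero (L L' : Lattice R K d) : redMap hπ L L' ≠ 0 := by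
  intro h
  have := exponent_le hπ L L' (n := exponent π L L' - 1) fun x hx => by
    rw [← redMap_red_eq_zero_iff hπ L L' ⟨x, hx⟩, h, LinearMap.zero_apply]
  omega

theorem redMap_self (L : Lattice R K d) : redMap hπ L L = LinearMap.id := by
  refine LinearMap.ext fun x => ?_
  obtain ⟨x, rfl⟩ := L.red_surjective x
  rw [redMap_red, LinearMap.id_apply]
  congr 1
  apply Subtype.ext
  simp [exponent_self hπ]

theorem redMap_comp {L₁ L₂ L₃ : Lattice R K d}
    (h : exponent π L₁ L₂ + exponent π L₂ L₃ = exponent π L₁ L₃) :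
    redMap hπ L₂ L₃ ∘ₗ redMap hπ L₁ L₂ = redMap hπ L₁ L₃ := by
  refine LinearMap.ext fun x => ?_
  obtain ⟨x, rfl⟩ := L₁.red_surjective x
  rw [LinearMap.comp_apply, redMap_red, redMap_red, redMap_red]
  congr 1
  apply Subtype.ext
  simp only [zpow_smul_zpow_smul hπ, ← h, add_comm]

/-- A strict triangle inequality leaves at least one extra factor `π`. -/
theorem redMap_comp_eq_zero {L₁ L₂ L₃ : Lattice R K d}
    (h : exponent π L₁ L₂ + exponent π L₂ L₃ ≠ exponent π L₁ L₃) :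
    redMap hπ L₂ L₃ ∘ₗ redMap hπ L₁ L₂ = 0 := by
  refine LinearMap.ext fun x => ?_
  obtain ⟨x, rfl⟩ := L₁.red_surjective x
  rw [LinearMap.comp_apply, redMap_red, LinearMap.zero_apply, redMap_red_eq_zero_iff,
    zpow_smul_zpow_smul hπ]
  have := exponent_triangle hπ L₁ L₂ L₃
  exact zpow_smul_mem_of_le hπ _ (by omega) (exponent_spec hπ L₁ L₃ x.1 x.2)

/-- The kernel of a map between reductions as the image of the intersection lattice. -/
theorem range_redMap_eq_ker {L L' N : Lattice R K d}
    (h : ∀ x, (algebraMap R K π) ^ (-exponent π N L) • x ∈ N.1 ↔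
      x ∈ L.1 ∧ (algebraMap R K π) ^ (exponent π L L' - 1) • x ∈ L'.1) :
    LinearMap.range (redMap hπ N L) = LinearMap.ker (redMap hπ L L') := by
  ext x
  constructor
  · rintro ⟨y, rfl⟩
    obtain ⟨y, rfl⟩ := N.red_surjective y
    rw [LinearMap.mem_ker, redMap_red, redMap_red_eq_zero_iff]
    refine ((h _).1 ?_).2
    rw [zpow_smul_zpow_smul hπ, neg_add_cancel, zpow_zero, one_smul]
    exact y.2
  · intro hx
    obtain ⟨x, rfl⟩ := L.red_surjective x
    rw [LinearMap.mem_ker, redMap_red_eq_zero_iff] at hx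
    refine ⟨N.red ⟨_, (h x.1).2 ⟨x.2, hx⟩⟩, ?_⟩
    rw [redMap_red]
    congr 1
    apply Subtype.ext
    simp only [zpow_smul_zpow_smul hπ, add_neg_cancel, zpow_zero, one_smul]

include hπ in
theorem one_le_exponent_add {L L' : Lattice R K d} (h : L.cls ≠ L'.cls) :
    1 ≤ exponent π L L' + exponent π L' L := by
  have h1 := exponent_triangle hπ L L' L
  rw [exponent_self hπ] at h1
  by_contra hlt
  have h2 : exponent π L' L = -exponent π L L' := by omega
  refine h (cls_eq_of_forall_mem_iff hπ (exponent π L' L) fun x => ⟨fun hx => ?_, fun hx => ?_⟩)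
  · rw [h2, neg_neg]
    exact exponent_spec hπ L L' x hx
  · have := exponent_spec hπ L' L _ hx
    rwa [zpow_smul_zpow_smul hπ, add_neg_cancel, zpow_zero, one_smul] at this

/-- In a convex configuration every kernel is the image of a neighbour. -/
theorem IsConvex.exists_neighbour {Γ : Set (LatticeClass R K d)} (hΓ : IsConvex Γ)
    {L : Γ → Lattice R K d} (hL : ∀ v : Γ, (L v).cls = v) {i j : Γ} (hij : i ≠ j) :
    ∃ s, exponent π (L i) (L s) + exponent π (L s) (L i) = 1 ∧
      LinearMap.range (redMap hπ (L s) (L i)) = LinearMap.ker (redMap hπ (L i) (L j)) := by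
  have hp := algebraMap_uniformizer_ne_zero (K := K) hπ
  have hcls : ∀ {i j : Γ}, i ≠ j → (L i).cls ≠ (L j).cls := fun h e =>
    h (Subtype.ext (by rwa [hL, hL] at e))
  set m := exponent π (L i) (L j)
  set n := exponent π (L j) (L i)
  have hmn : 1 ≤ m + n := one_le_exponent_add hπ (hcls hij)
  let a : Kˣ := Units.mk0 _ (zpow_ne_zero (1 - m) hp)
  -- `N` is `L i ∩ π^(1-m) L j`, the preimage in `L i` of the kernel; it lies between `π L i` and `L
  -- i`.
  set N := (L i).inter ((L j).scale a)
  have hNmem : ∀ x, x ∈ N.1 ↔ x ∈ (L i).1 ∧ (algebraMap R K π) ^ (m - 1) • x ∈ (L j).1 := by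
    intro x
    have : a⁻¹ • x = (algebraMap R K π) ^ (m - 1) • x := by
      rw [Units.smul_def, Units.val_inv_eq_inv_val, Units.val_mk0, ← zpow_neg, neg_sub]
    rw [← this, ← mem_units_smul_iff]
    rfl
  have hNΓ : N.cls ∈ Γ := hΓ _ _ (by rw [hL]; exact i.2) (by
    rw [Lattice.scale_cls, hL]; exact j.2)
  obtain ⟨k, hk⟩ := exists_zpow_of_cls_eq hπ (N := N) (L := L ⟨_, hNΓ⟩) (hL ⟨_, hNΓ⟩).symm
  set s : Γ := ⟨_, hNΓ⟩
  have h1 : exponent π (L s) (L i) ≤ k := exponent_le hπ _ _ fun x hx => by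
    refine ((hNmem _).1 ((hk _).2 ?_)).1
    rwa [zpow_smul_zpow_smul hπ, neg_add_cancel, zpow_zero, one_smul]
  have h2 : exponent π (L i) (L s) ≤ 1 - k := exponent_le hπ _ _ fun x hx => by
    rw [show 1 - k = -k + 1 by ring, ← zpow_smul_zpow_smul hπ]
    refine (hk _).1 ((hNmem _).2 ⟨?_, ?_⟩)
    · exact zpow_smul_mem_of_le hπ _ zero_le_one (by simpa using hx)
    · rw [zpow_smul_zpow_smul hπ, sub_add_cancel]
      exact exponent_spec hπ _ _ _ hx
  have hsi : i ≠ s := by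
    intro e
    rw [← e, exponent_self hπ] at h1 h2
    rw [← e] at hk
    -- `N = L i` would contradict the minimality of `m`. If `N = π L i`, then `π^n L j ⊆ N`, because
    -- `m + n ≥ 1`, contradicts the minimality of `n`.
    obtain rfl | rfl : k = 0 ∨ k = 1 := by omega
    · have := exponent_le hπ (L i) (L j) (n := m - 1) fun x hx =>
        ((hNmem x).1 ((hk x).2 (by simpa using hx))).2
      omega
    · have := exponent_le hπ (L j) (L i) (n := n - 1) fun x hx => by
        rw [show n - 1 = -1 + n by ring, ← zpow_smul_zpow_smul hπ]
        refine (hk _).1 ((hNmem _).2 ⟨exponent_spec hπ _ _ _ hx, ?_⟩)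
        rw [zpow_smul_zpow_smul hπ]
        exact zpow_smul_mem_of_le hπ _ (m := 0) (by omega) (by simpa using hx)
      omega
  have h3 := one_le_exponent_add hπ (hcls hsi)
  have h4 : exponent π (L s) (L i) = k := by omega
  refine ⟨s, by omega, range_redMap_eq_ker hπ fun x => ?_⟩
  rw [h4, ← hk, hNmem]

/-- The exponents and reduction maps of a convex configuration. -/
def exponentSystem {Γ : Set (LatticeClass R K d)} (hΓ : IsConvex Γ)
    (L : Γ → Lattice R K d) (hL : ∀ v : Γ, (L v).cls = v) :
    ExponentSystem (IsLocalRing.ResidueField R) fun v : Γ => Reduction (L v) where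
  n i j := exponent π (L i) (L j)
  f i j := redMap hπ (L i) (L j)
  n_self i := exponent_self hπ _
  n_triangle i j l := exponent_triangle hπ _ _ _
  f_self i := redMap_self hπ _
  f_comp i j l h := redMap_comp hπ h
  f_comp_zero i j l h := redMap_comp_eq_zero hπ h
  f_ne_zero i j := redMap_ne_zero hπ _ _
  one_le i j h := one_le_exponent_add hπ fun e => h (Subtype.ext (by rwa [hL, hL] at e))
  exists_neighbour i j h := hΓ.exists_neighbour hπ hL h

/-- The condition im = ker serves to exclude `v ∈ I v`, where both maps are the identity. A
factorization of a nonzero map forces equality of exponents. -/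
theorem IsLocallyWeaklyIndependent.exists_weaklyIndependent {Γ : Set (LatticeClass R K d)}
    {L : Γ → Lattice R K d} (hL : ∀ v : Γ, (L v).cls = v)
    (h : IsLocallyWeaklyIndependent hπ Γ L) :
    ∃ I : Γ → Set Γ, (exponentSystem hπ h.1 L hL).WeaklyIndependent I := by
  choose I h1 h2 h3 using h.2
  refine ⟨I, fun v hv => ?_, fun v u huv => ?_, h3⟩
  · have := h2 v v hv
    rw [redMap_self, LinearMap.range_id, LinearMap.ker_id] at this
    exact redMap_ne_zero hπ (L v) (L v) (LinearMap.ext fun x =>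
      ((Submodule.mem_bot _).1 (this ▸ Submodule.mem_top : redMap hπ (L v) (L v) x ∈ ⊥)))
  · obtain ⟨w, hw, hf⟩ := h1 v u huv
    refine ⟨w, hw, ?_⟩
    by_contra hne
    exact redMap_ne_zero hπ _ _ (hf.trans (redMap_comp_eq_zero hπ hne))

instance (L : Lattice R K d) : FiniteDimensional (IsLocalRing.ResidueField R) (Reduction L) := by
  have : Module.Finite R L.1 := Module.Finite.iff_fg.2 L.2.fg
  exact inferInstanceAs (Module.Finite (R ⧸ IsLocalRing.maximalIdeal R)
    (L.1 ⧸ (IsLocalRing.maximalIdeal R • ⊤ : Submodule R L.1)))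

end RedMap

end LatticeConfig

end

noncomputable section

namespace LatticeConfig

variable {R : Type u} [CommRing R] [IsDomain R] [IsDiscreteValuationRing R]
variable {K : Type w} [Field K] [Algebra R K] [IsFractionRing R K]
variable {d : ℕ} {π : R}

/-! ### Lifting to an apartment -/

section Apartment

theorem residue_smul_red (L : Lattice R K d) (r : R) (x : L.1) :
    IsLocalRing.residue R r • L.red x = L.red (r • x) := rfl

/-- Nakayama's lemma: lifts of generators of the reduction generate the lattice. -/
theorem Lattice.span_eq_top_of_red (L : Lattice R K d) {α : Type*} [Fintype α] (x : α → L.1)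
    (h : ∀ y : Reduction L, ∃ c : α → IsLocalRing.ResidueField R, ∑ a, c a • L.red (x a) = y) :
    Submodule.span R (Set.range x) = ⊤ := by
  have : Module.Finite R L.1 := Module.Finite.iff_fg.2 L.2.fg
  rw [← IsLocalRing.map_mkQ_eq_top, eq_top_iff]
  rintro y -
  obtain ⟨c, rfl⟩ := h y
  choose r hr using fun a => IsLocalRing.residue_surjective (c a)
  refine Submodule.sum_mem _ fun a _ => ?_
  rw [← hr, residue_smul_red]
  exact ⟨r a • x a, Submodule.smul_mem _ _ (Submodule.subset_span ⟨a, rfl⟩), rfl⟩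

theorem Lattice.finrank_reduction_le (L : Lattice R K d) :
    Module.finrank (IsLocalRing.ResidueField R) (Reduction L) ≤ d := by
  have := L.2
  have hrank : Module.finrank R L.1 = d := by
    rw [Submodule.IsLattice.finrank_of_pi K L.1, Fintype.card_fin]
  let b := Module.finBasisOfFinrankEq R L.1 hrank
  have hspan : Submodule.span (IsLocalRing.ResidueField R) (Set.range fun a => L.red (b a)) = ⊤ := by
    rw [eq_top_iff]
    rintro y -
    obtain ⟨y, rfl⟩ := L.red_surjective y
    have hy : L.red y = ∑ a, IsLocalRing.residue R (b.repr y a) • L.red (b a) := by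
      conv_lhs => rw [← b.sum_repr y]
      exact map_sum (Submodule.mkQ (IsLocalRing.maximalIdeal R • ⊤ : Submodule R L.1)) _ _
    rw [hy]
    exact Submodule.sum_mem _ fun a _ => Submodule.smul_mem _ _ (Submodule.subset_span ⟨a, rfl⟩)
  have := finrank_range_le_card (R := IsLocalRing.ResidueField R) fun a => L.red (b a)
  rwa [Set.finrank, hspan, finrank_top, Fintype.card_fin] at this

variable [NeZero d] (hπ : Irreducible π)

/-- Vectors whose images are bases of all reductions lift to a basis of an apartment. -/
theorem exists_subset_apartment {Γ : Set (LatticeClass R K d)}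
    {L : Γ → Lattice R K d} (hL : ∀ v : Γ, (L v).cls = v) {m : ℕ} (v : Fin m → Γ)
    (e : ∀ a, Reduction (L (v a)))
    (h : ∀ i, ∃ b : Module.Basis (Fin m) (IsLocalRing.ResidueField R) (Reduction (L i)),
      ∀ a, b a = redMap hπ (L (v a)) (L i) (e a)) :
    ∃ b : Module.Basis (Fin d) K (Fin d → K), Γ ⊆ apartment π b := by
  rcases isEmpty_or_nonempty Γ with hΓ | ⟨⟨i₀⟩⟩
  · exact ⟨Pi.basisFun K (Fin d), fun c hc => (hΓ.false ⟨c, hc⟩).elim⟩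
  choose x hx using fun a => (L (v a)).red_surjective (e a)
  -- The same lifts serve all lattices; only the power of `π` depends on `i`.
  let y : ∀ i, Fin m → (L i).1 := fun i a =>
    ⟨_, exponent_spec hπ (L (v a)) (L i) (x a).1 (x a).2⟩
  have hspan : ∀ i, Submodule.span R (Set.range (y i)) = ⊤ := by
    intro i
    obtain ⟨b, hb⟩ := h i
    refine (L i).span_eq_top_of_red (y i) fun z => ⟨b.repr z, ?_⟩
    conv_rhs => rw [← b.sum_repr z]
    refine Finset.sum_congr rfl fun a _ => ?_
    rw [hb, ← hx, redMap_red]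
  have hspan' : ∀ i, (L i).1 = Submodule.span R (Set.range fun a =>
      (algebraMap R K π) ^ exponent π (L (v a)) (L i) • (x a).1) := by
    intro i
    have := congrArg (Submodule.map (L i).1.subtype) (hspan i)
    rw [Submodule.map_span, ← Set.range_comp, Submodule.map_top, Submodule.range_subtype] at this
    exact this.symm
  have htop : ⊤ ≤ Submodule.span K (Set.range fun a => (x a).1) := by
    rw [← (L i₀).2.span_eq_top, Submodule.span_le]
    intro z hz
    rw [SetLike.mem_coe, hspan' i₀] at hz
    refine (Submodule.span_le.2 ?_ :
      _ ≤ (Submodule.span K (Set.range fun a => (x a).1)).restrictScalars R) hz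
    rintro _ ⟨a, rfl⟩
    exact (Submodule.span K (Set.range fun a => (x a).1)).smul_mem _
      (Submodule.subset_span (Set.mem_range_self a))
  -- The reduction has dimension `m`, at most `d`, while the `m` lifts span `K ^ d`.
  have hmd : m = d := by
    apply le_antisymm
    · obtain ⟨b, -⟩ := h i₀
      have := (L i₀).finrank_reduction_le
      rwa [Module.finrank_eq_card_basis b, Fintype.card_fin] at this
    · have := finrank_range_le_card (R := K) fun a => (x a).1
      rwa [Set.finrank, top_le_iff.1 htop, finrank_top, Module.finrank_fin_fun,
        Fintype.card_fin] at this
  subst hmd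
  refine ⟨basisOfTopLeSpanOfCardEqFinrank _ htop (by simp), fun c hc => ?_⟩
  refine ⟨fun a => exponent π (L (v a)) (L ⟨c, hc⟩), L ⟨c, hc⟩, ?_, hL _⟩
  rw [coe_basisOfTopLeSpanOfCardEqFinrank]
  exact hspan' _

end Apartment

/-! ### Paths in the complete quiver and in Q(Γ) -/

section Quiver

variable [NeZero d] (hπ : Irreducible π) {Γ : Set (LatticeClass R K d)} (L : Γ → Lattice R K d)

/-- A point of the configuration as an object of the path category. -/
def vertex (i : Γ) : Paths (ConfigQuiver hπ L) := (Paths.of (ConfigQuiver hπ L)).obj i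

/-- The map between two reductions as a morphism between the values of the representation. -/
def repHom (i j : Γ) :
    (configRep hπ L).obj (vertex hπ L i) ⟶ (configRep hπ L).obj (vertex hπ L j) :=
  ModuleCat.ofHom (redMap hπ (L i) (L j))

theorem repHom_self (i : Γ) : repHom hπ L i i = 𝟙 _ := by
  rw [repHom, redMap_self]; rfl

theorem repHom_comp {i j l : Γ}
    (h : exponent π (L i) (L j) + exponent π (L j) (L l) = exponent π (L i) (L l)) :
    repHom hπ L i j ≫ repHom hπ L j l = repHom hπ L i l := by
  rw [repHom, repHom, repHom, ← redMap_comp hπ h]; rfl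

theorem repHom_comp_eq_zero {i j l : Γ}
    (h : exponent π (L i) (L j) + exponent π (L j) (L l) ≠ exponent π (L i) (L l)) :
    repHom hπ L i j ≫ repHom hπ L j l = 0 := by
  have : repHom hπ L i j ≫ repHom hπ L j l =
    ModuleCat.ofHom (redMap hπ (L j) (L l) ∘ₗ redMap hπ (L i) (L j)) := rfl
  rw [this, redMap_comp_eq_zero hπ h]; rfl

theorem configRep_map_arrow {i j : ConfigQuiver hπ L} (e : i ⟶ j) :
    (configRep hπ L).map ((Paths.of _).map e) = repHom hπ L i j :=
  Paths.lift_toPath _ _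

/-- A path acts as the map between the reductions at its end points or as zero. -/
theorem configRep_map_eq_or {i j : Γ} (p : vertex hπ L i ⟶ vertex hπ L j) :
    (configRep hπ L).map p = repHom hπ L i j ∨ (configRep hπ L).map p = 0 := by
  refine Paths.induction_fixed_source (a := vertex hπ L i) (fun {b} p =>
    (configRep hπ L).map p = repHom hπ L i b ∨ (configRep hπ L).map p = 0) ?_ ?_ p
  · exact Or.inl (((configRep hπ L).map_id _).trans (repHom_self hπ L i).symm)
  · intro j l p e hp
    rw [Functor.map_comp, configRep_map_arrow]
    rcases hp with hp | hp
    · rw [hp]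
      by_cases h : exponent π (L i) (L j) + exponent π (L j) (L l) = exponent π (L i) (L l)
      · exact Or.inl (repHom_comp hπ L h)
      · exact Or.inr (repHom_comp_eq_zero hπ L h)
    · rw [hp]
      exact Or.inr Limits.zero_comp

theorem pathMap_cons {i j l : CompleteQuiver Γ} (p : Quiver.Path i j) (e : j ⟶ l) :
    pathMap hπ L (p.cons e) = redMap hπ (L j) (L l) ∘ₗ pathMap hπ L p := rfl

theorem pathMap_eq_or {i j : CompleteQuiver Γ} (p : Quiver.Path i j) :
    pathMap hπ L p = redMap hπ (L i) (L j) ∨ pathMap hπ L p = 0 := by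
  induction p with
  | nil => exact Or.inl (redMap_self hπ _).symm
  | @cons j l p e ih =>
    rw [pathMap_cons]
    rcases ih with ih | ih
    · rw [ih]
      by_cases h : exponent π (L i) (L j) + exponent π (L j) (L l) = exponent π (L i) (L l)
      · exact Or.inl (redMap_comp hπ h)
      · exact Or.inr (redMap_comp_eq_zero hπ h)
    · rw [ih]
      exact Or.inr (LinearMap.comp_zero _)

variable {L} (hΓ : IsConvex Γ) (hL : ∀ v : Γ, (L v).cls = v)
include hΓ hL

/-- A nontrivial closed path acts as zero, since a round trip between distinct vertices has positive
length. -/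
theorem ne_of_pathMap_ne_zero {i j : CompleteQuiver Γ} (p : Quiver.Path i j)
    (hp : 1 ≤ p.length) (h : pathMap hπ L p ≠ 0) : i ≠ j := by
  rintro rfl
  cases p with
  | nil => simp at hp
  | @cons m _ p e =>
    rw [pathMap_cons] at h
    rcases pathMap_eq_or hπ L p with h' | h'
    · rw [h'] at h
      exact h (redMap_comp_eq_zero hπ
        ((exponentSystem hπ hΓ L hL).not_btw_of_ne (i := i) (j := m) e.down.symm))
    · rw [h'] at h
      exact h (LinearMap.comp_zero _)

/-- The penultimate vertex of the path works; it differs from `i` because the path up to it acts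
nontrivially. -/
theorem exists_btw_of_path {i j : CompleteQuiver Γ} (p : Quiver.Path i j) (hlen : 2 ≤ p.length)
    (hp : pathMap hπ L p = redMap hπ (L i) (L j)) :
    ∃ m : Γ, i ≠ m ∧ m ≠ j ∧ (exponentSystem hπ hΓ L hL).Btw i m j := by
  cases p with
  | nil => simp at hlen
  | @cons m _ p e =>
    rw [Quiver.Path.length_cons] at hlen
    rw [pathMap_cons] at hp
    have hne : pathMap hπ L p ≠ 0 := by
      intro h
      rw [h] at hp
      exact redMap_ne_zero hπ (L i) (L j) (hp.symm.trans (LinearMap.comp_zero _))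
    rw [(pathMap_eq_or hπ L p).resolve_right hne] at hp
    refine ⟨m, ne_of_pathMap_ne_zero hπ hΓ hL p (by omega) hne, e.down, ?_⟩
    by_contra hb
    exact redMap_ne_zero hπ (L i) (L j) (hp.symm.trans (redMap_comp_eq_zero hπ hb))

/-- All maps between the reductions are induced by paths of the quiver of the configuration. -/
theorem exists_path [Finite Γ] (i j : Γ) :
    ∃ p : vertex hπ L i ⟶ vertex hπ L j, (configRep hπ L).map p = repHom hπ L i j := by
  set S := exponentSystem hπ hΓ L hL
  induction hn : (S.interval i j).ncard using Nat.strong_induction_on generalizing i j with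
  | _ n ih =>
    subst hn
    by_cases hij : i = j
    · subst hij
      exact ⟨𝟙 _, ((configRep hπ L).map_id _).trans (repHom_self hπ L i).symm⟩
    by_cases hex : ∃ p : Quiver.Path (V := CompleteQuiver Γ) i j,
      2 ≤ p.length ∧ pathMap hπ L p = redMap hπ (L i) (L j)
    · obtain ⟨p, hlen, hp⟩ := hex
      -- A removed arrow is replaced by the two halves of a geodesic, each with a smaller interval.
      obtain ⟨m, him, hmj, hb⟩ := exists_btw_of_path hπ hΓ hL p hlen hp
      obtain ⟨p₁, hp₁⟩ := ih _ (S.interval_ncard_lt_left hb hmj) i m rfl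
      obtain ⟨p₂, hp₂⟩ := ih _ (S.interval_ncard_lt_right hb him) m j rfl
      exact ⟨p₁ ≫ p₂, by rw [Functor.map_comp, hp₁, hp₂]; exact repHom_comp hπ L hb⟩
    · exact ⟨(Paths.of (ConfigQuiver hπ L)).map (X := i) (Y := j) ⟨hij, hex⟩,
        configRep_map_arrow hπ L _⟩

end Quiver

end LatticeConfig

end

/-! ### Projectivity of bound representations -/

noncomputable section

namespace QuiverRep

variable {k : Type u} [Field k] {Q : Type*} [Quiver Q] {M : Paths Q ⥤ ModuleCat.{w} k}

/-- A sub-representation is stable under all paths. -/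
theorem SubRep.le_comap_map (N : SubRep M) {i j : Paths Q} (p : i ⟶ j) :
    N.space i ≤ (N.space j).comap (M.map p).hom := by
  refine Paths.induction_fixed_source (a := i) (fun {b} p =>
    N.space i ≤ (N.space b).comap (M.map p).hom) ?_ ?_ p
  · intro x hx
    rw [M.map_id]
    exact hx
  · intro j l p e hp x hx
    rw [M.map_comp]
    exact N.stable e (hp hx)

/-- The relations of `M` pass to cokernels. -/
theorem SatisfiesRelationsOf.cokernel {X Y : Paths Q ⥤ ModuleCat.{w} k}
    (hY : SatisfiesRelationsOf M Y) (g : X ⟶ Y) :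
    SatisfiesRelationsOf M (Limits.cokernel g) := by
  refine fun i j => ⟨fun p q h => ?_, fun p h => ?_⟩
  · rw [← cancel_epi ((Limits.cokernel.π g).app i), ← NatTrans.naturality, ← NatTrans.naturality,
      (hY i j).1 p q h]
  · rw [← cancel_epi ((Limits.cokernel.π g).app i), ← NatTrans.naturality, (hY i j).2 p h,
      Limits.zero_comp, Limits.comp_zero]

/-- Epimorphisms of bound representations are surjective at every vertex. -/
theorem surjective_of_epi
    {X Y : (SatisfiesRelationsOf M : ObjectProperty (Paths Q ⥤ ModuleCat.{w} k)).FullSubcategory}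
    (g : X ⟶ Y) [Epi g]
    (i : Paths Q) : Function.Surjective (g.hom.app i).hom := by
  have hepi : Epi g.hom := by
    apply Abelian.epi_of_cokernel_π_eq_zero
    -- The ambient cokernel satisfies the relations, so it can test the epimorphism inside the full
    -- subcategory.
    let C : (SatisfiesRelationsOf M : ObjectProperty (Paths Q ⥤ ModuleCat.{w} k)).FullSubcategory :=
      ⟨_, SatisfiesRelationsOf.cokernel (M := M) Y.property g.hom⟩
    let c : Y ⟶ C := ObjectProperty.homMk (Limits.cokernel.π g.hom)
    let z : Y ⟶ C := ObjectProperty.homMk 0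
    have h : g ≫ c = g ≫ z := by
      apply ObjectProperty.hom_ext
      change g.hom ≫ Limits.cokernel.π g.hom = g.hom ≫ 0
      rw [Limits.cokernel.condition, Limits.comp_zero]
    rw [cancel_epi] at h
    exact congrArg (fun f => f.hom) h
  exact (ModuleCat.epi_iff_surjective _).1 inferInstance

/-- A representation with vectors `e a` at vertices `v a` whose images along suitable paths form
bases at all vertices, and whose images along other paths vanish, is projective. -/
theorem isProjectiveBound_of_basis {m : ℕ} (v : Fin m → Paths Q) (e : ∀ a, M.obj (v a))
    (p : ∀ i j : Paths Q, i ⟶ j)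
    (hp : ∀ {i j : Paths Q} (q : i ⟶ j), M.map q = M.map (p i j) ∨ M.map q = 0)
    (b : ∀ i, Module.Basis (Fin m) k (M.obj i))
    (hb : ∀ i a, b i a = (M.map (p (v a) i)).hom (e a)) :
    IsProjectiveBound M := by
  constructor
  intro X Y f g _
  choose x hx using fun a => surjective_of_epi g (v a) ((f.hom.app (v a)).hom (e a))
  let l : ∀ i, M.obj i ⟶ X.obj.obj i := fun i =>
    ModuleCat.ofHom ((b i).constr k fun a => (X.obj.map (p (v a) i)).hom (x a))
  have hl : ∀ i a, (l i).hom (b i a) = (X.obj.map (p (v a) i)).hom (x a) := fun i a =>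
    (b i).constr_basis k _ a
  have hnat : ∀ {i j : Paths Q} (q : i ⟶ j), M.map q ≫ l j = l i ≫ X.obj.map q := by
    intro i j q
    apply ModuleCat.hom_ext
    refine (b i).ext fun a => ?_
    have hM : (M.map q).hom (b i a) = (M.map (p (v a) i ≫ q)).hom (e a) := by
      rw [hb, M.map_comp]; rfl
    have hX : (X.obj.map q).hom ((l i).hom (b i a)) =
        (X.obj.map (p (v a) i ≫ q)).hom (x a) := by
      rw [hl, X.obj.map_comp]; rfl
    change (l j).hom ((M.map q).hom (b i a)) = (X.obj.map q).hom ((l i).hom (b i a))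
    rw [hM, hX]
    -- On `M` this path acts like `p (v a) j` or as zero, and the relations force the same on `X`.
    rcases hp (p (v a) i ≫ q) with h | h
    · rw [h, (X.property _ _).1 _ _ h, ← hb, hl]
    · rw [h, (X.property _ _).2 _ h]
      simp
  refine ⟨ObjectProperty.homMk { app := l, naturality := fun _ _ q => hnat q }, ?_⟩
  apply ObjectProperty.hom_ext
  ext i : 2
  apply ModuleCat.hom_ext
  refine (b i).ext fun a => ?_
  change (g.hom.app i).hom ((l i).hom (b i a)) = (f.hom.app i).hom (b i a)
  rw [hl, hb]
  have h1 := congrArg (fun φ => φ.hom (x a)) (g.hom.naturality (p (v a) i))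
  have h2 := congrArg (fun φ => φ.hom (e a)) (f.hom.naturality (p (v a) i))
  refine h1.trans (Eq.trans ?_ h2.symm)
  exact congrArg (Y.obj.map (p (v a) i)).hom (hx a)

end QuiverRep

/-! ### Generated sub-representations and the main theorem -/

namespace LatticeConfig

variable {R : Type u} [CommRing R] [IsDomain R] [IsDiscreteValuationRing R]
variable {K : Type w} [Field K] [Algebra R K] [IsFractionRing R K]
variable {d : ℕ} {π : R} [NeZero d] (hπ : Irreducible π) {Γ : Set (LatticeClass R K d)}
  (L : Γ → Lattice R K d)

/-- The sub-representation generated by a vector. -/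
def generatedSubRep (v : Γ) (x : Reduction (L v)) : QuiverRep.SubRep (configRep hπ L) where
  space i := Submodule.span (IsLocalRing.ResidueField R) {redMap hπ (L v) (L i) x}
  stable {i j} e := by
    rw [configRep_map_arrow]
    refine (Submodule.span_singleton_le_iff_mem _ _).2 ?_
    change redMap hπ (L i) (L j) (redMap hπ (L v) (L i) x) ∈
      Submodule.span (IsLocalRing.ResidueField R) {redMap hπ (L v) (L j) x}
    change (redMap hπ (L i) (L j) ∘ₗ redMap hπ (L v) (L i)) x ∈ _
    by_cases h : exponent π (L v) (L i) + exponent π (L i) (L j) = exponent π (L v) (L j)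
    · rw [redMap_comp hπ h]
      exact Submodule.mem_span_singleton_self _
    · rw [redMap_comp_eq_zero hπ h]
      exact Submodule.zero_mem _

variable {L} (hΓ : IsConvex Γ) (hL : ∀ v : Γ, (L v).cls = v)
include hΓ hL

/-- A sub-representation is stable under the maps between all pairs of reductions. -/
theorem subRep_le_comap [Finite Γ] (U : QuiverRep.SubRep (configRep hπ L)) (i j : Γ) :
    U.space i ≤ (U.space j).comap (redMap hπ (L i) (L j)) := by
  obtain ⟨p, hp⟩ := exists_path hπ hΓ hL i j
  have := U.le_comap_map p
  rw [hp] at this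
  exact this

theorem generatedSubRep_isGeneratedBy [Finite Γ] (v : Γ) (x : Reduction (L v)) :
    (generatedSubRep hπ L v x).IsGeneratedBy v x := by
  refine ⟨?_, fun T hT i => ?_⟩
  · change x ∈ Submodule.span (IsLocalRing.ResidueField R) {redMap hπ (L v) (L v) x}
    rw [redMap_self]
    exact Submodule.mem_span_singleton_self _
  · change Submodule.span (IsLocalRing.ResidueField R) {redMap hπ (L v) (L i) x} ≤ _
    exact (Submodule.span_singleton_le_iff_mem _ _).2 (subRep_le_comap hπ hΓ hL T v i hT)

end LatticeConfig

end

theorem mainTheorem1 {R : Type u} [CommRing R] [IsDomain R] [IsDiscreteValuationRing R]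
    [IsAlgClosed (IsLocalRing.ResidueField R)]
    {K : Type w} [Field K] [Algebra R K] [IsFractionRing R K]
    {π : R} (hπ : Irreducible π) {d : ℕ} [NeZero d]
    (Γ : Set (LatticeConfig.LatticeClass R K d)) (hfin : Γ.Finite)
    (L : Γ → LatticeConfig.Lattice R K d) (hL : ∀ v : Γ, (L v).cls = v)
    (hΓ : LatticeConfig.IsLocallyWeaklyIndependent hπ Γ L) :
    (∀ U : QuiverRep.SubRep (LatticeConfig.configRep hπ L),
      ∃ (n : ℕ) (N : Fin n → QuiverRep.SubRep (LatticeConfig.configRep hπ L)),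
        U.IsDirectSum N ∧
        ∀ a, (∃ v x, (N a).IsGeneratedBy v x) ∧
          ∀ i, Module.rank (IsLocalRing.ResidueField R) ((N a).space i) ≤ 1) ∧
    QuiverRep.IsProjectiveBound (LatticeConfig.configRep hπ L) ∧
    ∃ b : Module.Basis (Fin d) K (Fin d → K), Γ ⊆ LatticeConfig.apartment π b := by
  have := hfin.to_subtype
  obtain ⟨I, hI⟩ := hΓ.exists_weaklyIndependent hπ hL
  obtain ⟨m, v, e, hb⟩ := hI.exists_basis
  refine ⟨fun U => ?_, ?_, LatticeConfig.exists_subset_apartment hπ hL v e hb⟩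
  · obtain ⟨n, v, x, -, -, hx⟩ := hI.exists_generators (U := fun i => U.space i)
      (LatticeConfig.subRep_le_comap hπ hΓ.1 hL U)
    refine ⟨n, fun a => LatticeConfig.generatedSubRep hπ L (v a) (x a), hx, fun a =>
      ⟨⟨v a, x a, LatticeConfig.generatedSubRep_isGeneratedBy hπ hΓ.1 hL _ _⟩, fun i => ?_⟩⟩
    exact (rank_span_le _).trans (Cardinal.mk_singleton _).le
  · choose b hb using hb
    choose p hp using LatticeConfig.exists_path hπ hΓ.1 hL
    refine QuiverRep.isProjectiveBound_of_basis (fun a => LatticeConfig.vertex hπ L (v a)) e p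
      (fun {i j} q => ?_) b fun i a => ?_
    · exact (LatticeConfig.configRep_map_eq_or hπ L q).imp_left fun h => h.trans (hp i j).symm
    · exact (hb i a).trans (congrArg (fun φ => φ.hom (e a)) (hp (v a) i)).symm
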